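/- **Setting.** A finite ground set $X$ with $n$ elements carries a set function $f:2^X\to\mathbb R_{\ge 0}$ that is monotone ($f(T\cup\{x\})\ge f(T)$) and submodular ($f(S\cup\{x\})-f(S)\ge f(T\cup\{x\})-f(T)$ for $S\subseteq T$, $x\notin T$). The elements arrive one by one in an order $x_1,\dots,x_n$; let $X_t=\{x_1,\dots,x_t\}$ and, for a cardinality bound $k\in\mathbb N$, let $f(\mathrm{OPT}_t)=\max\{f(S): S\subseteq X_t,\ |S|\le k\}$. Ground set, order and $f$ are fixed in advance (oblivious adversary). An online algorithm is given $k$, does not know $n$, keeps its memory between time steps, and after the arrival of $x_t$ may query a value oracle for $f$ on subsets of $X_t$ only; it then outputs a solution $\mathrm{ALG}_t\subseteq X_t$ (with $\mathrm{ALG}_0=\emptyset$). Algorithms are fixed finite programs on a random access machine with memory cells for natural numbers and for real numbers; additions, subtractions, comparisons, assignments, value queries, and draws of a uniformly random element of $\{0,\dots,m\}$ each take constant time. **Theorem.** There are absolute constants $C_1,C_2>0$ such that for every $\varepsilon\in(0,1)$ there are a randomized online algorithm and a polynomial $p$ with the following properties, for every $k$, every finite ground set $X$, every monotone submodular $f:2^X\to\mathbb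 R_{\ge0}$ and every arrival order of $X$: 1. (feasibility) for all outcomes of the random draws, $|\mathrm{ALG}_t|\le k$ for all $t$; 2. (consistency) for all outcomes of the random draws, $|\mathrm{ALG}_t\setminus\mathrm{ALG}_{t-1}|\le C_1/\varepsilon^2$ for all $t\geq 1$; 3. (approximation) $\mathbb E[f(\mathrm{ALG}_t)]\ge(0.51-C_2\,\varepsilon)\, f(\mathrm{OPT}_t)$ for all $t$; 4. (polynomial time) for all outcomes of the random draws, the total running time of the first $t$ time steps is at most $p(t)$, for all $t$. -/

import Mathlib

namespace ConsistentSubmodular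

/-! ### Monotone submodular functions and the dynamic optimum -/

section SetFunctions

variable {X : Type*} [DecidableEq X]

/-- The marginal gain `f(S | T) = f(S ∪ T) - f(T)`. -/
def marginal (f : Finset X → ℝ) (S T : Finset X) : ℝ := f (S ∪ T) - f T

/-- `f(x | T) ≥ 0` for every element `x` and every set `T`. -/
def IsMonotone (f : Finset X → ℝ) : Prop := ∀ (x : X) (T : Finset X), 0 ≤ marginal f {x} T

/-- `f(x | S) ≥ f(x | T)` whenever `S ⊆ T` and `x ∉ T`. -/
def IsSubmodular (f : Finset X → ℝ) : Prop :=
  ∀ S T : Finset X, S ⊆ T → ∀ x ∉ T, marginal f {x} T ≤ marginal f {x} S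

/-- The maximum of `f` over the subsets of `V` of cardinality at most `k`. -/
noncomputable def opt (f : Finset X → ℝ) (k : ℕ) (V : Finset X) : ℝ :=
  (V.powerset.filter fun S => S.card ≤ k).sup' ⟨∅, by simp⟩ f

end SetFunctions

/-! ### Randomized oracle programs

The machine is a random access machine with finitely many program-addressable arrays (every array
has cells indexed by `ℕ`) of natural numbers and of real numbers, and a clock.  Programs are finite
pieces of text, independent of the input.  The only operations on numbers are addition,
subtraction and comparison, so that in unit-cost time `T` natural numbers of only `O(T)` more bits
than the inputs can be built, and no real operation other than the linear ones and `≤` is available.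
Loops are counted loops (`loop e c` evaluates `e` once and then runs `c` that many times), so every
program halts on every input and for every outcome of its random draws; every polynomial-time
computation can be written in this form. -/

/-- Terms of type natural number. -/
inductive NatTerm : Type
  /-- a literal of the program text -/
  | lit (n : ℕ)
  /-- the cardinality bound `k`, an input of the program -/
  | bound
  /-- the number of elements that have arrived so far -/
  | arrivals
  /-- the cell with index `i` of the `a`-th array of natural numbers -/
  | get (a : ℕ) (i : NatTerm)
  | add (e₁ e₂ : NatTerm)
  /-- truncated subtraction -/
  | sub (e₁ e₂ : NatTerm)

/-- Terms of type real number. -/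
inductive RealTerm : Type
  /-- the cell with index `i` of the `a`-th array of real numbers -/
  | get (a : ℕ) (i : NatTerm)
  | add (r₁ r₂ : RealTerm)
  | sub (r₁ r₂ : RealTerm)

/-- Tests. -/
inductive Test : Type
  | natLE (e₁ e₂ : NatTerm)
  | realLE (r₁ r₂ : RealTerm)
  | not (b : Test)
  | and (b₁ b₂ : Test)

/-- Programs. -/
inductive Program : Type
  | skip
  /-- cell `i` of the `a`-th array of natural numbers := `e` -/
  | setNat (a : ℕ) (i e : NatTerm)
  /-- cell `i` of the `a`-th array of real numbers := `r` -/
  | setReal (a : ℕ) (i : NatTerm) (r : RealTerm)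
  /-- cell `i` of the `a`-th array of real numbers := the value of the set of those elements arrived
  so far whose entries in the `b`-th array of natural numbers are nonzero -/
  | query (a : ℕ) (i : NatTerm) (b : ℕ)
  /-- cell `i` of the `a`-th array of natural numbers := a fresh uniformly random element
  of `{0, …, e}` -/
  | draw (a : ℕ) (i e : NatTerm)
  | seq (c₁ c₂ : Program)
  | ite (b : Test) (c₁ c₂ : Program)
  /-- run `c` as many times as the value of `e` on entering the loop -/
  | loop (e : NatTerm) (c : Program)

/-- A memory configuration.  The clock cannot be read by programs. -/
structure State where
  nat : ℕ → ℕ → ℕ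
  real : ℕ → ℕ → ℝ
  clock : ℕ

/-- All cells are zero and the clock is at zero. -/
def State.init : State := ⟨fun _ _ => 0, fun _ _ => 0, 0⟩

def State.tick (s : State) : State := { s with clock := s.clock + 1 }

def State.setNat (s : State) (a i v : ℕ) : State :=
  { s with nat := Function.update s.nat a (Function.update (s.nat a) i v) }

def State.setReal (s : State) (a i : ℕ) (v : ℝ) : State :=
  { s with real := Function.update s.real a (Function.update (s.real a) i v) }

/-- Value of a term when the cardinality bound is `k` and `t` elements have arrived. -/
def NatTerm.eval (k t : ℕ) (s : State) : NatTerm → ℕ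
  | .lit n => n
  | .bound => k
  | .arrivals => t
  | .get a i => s.nat a (i.eval k t s)
  | .add e₁ e₂ => e₁.eval k t s + e₂.eval k t s
  | .sub e₁ e₂ => e₁.eval k t s - e₂.eval k t s

noncomputable def RealTerm.eval (k t : ℕ) (s : State) : RealTerm → ℝ
  | .get a i => s.real a (i.eval k t s)
  | .add r₁ r₂ => r₁.eval k t s + r₂.eval k t s
  | .sub r₁ r₂ => r₁.eval k t s - r₂.eval k t s

def Test.Holds (k t : ℕ) (s : State) : Test → Prop
  | .natLE e₁ e₂ => e₁.eval k t s ≤ e₂.eval k t s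
  | .realLE r₁ r₂ => r₁.eval k t s ≤ r₂.eval k t s
  | .not b => ¬ b.Holds k t s
  | .and b₁ b₂ => b₁.Holds k t s ∧ b₂.Holds k t s

/-- Run a randomized computation `n` times in a row. -/
noncomputable def repeatPMF {σ : Type} (m : σ → PMF σ) : ℕ → σ → PMF σ
  | 0, s => PMF.pure s
  | n + 1, s => (m s).bind (repeatPMF m n)

open Classical in
/-- The distribution of the final configuration of a program.  The value oracle `O` takes the array
that describes the queried set.  Every assignment, value query, random draw, test and loop
iteration costs one unit of time. -/
noncomputable def Program.exec (k t : ℕ) (O : (ℕ → ℕ) → ℝ) : Program → State → PMF State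
  | .skip, s => PMF.pure s.tick
  | .setNat a i e, s => PMF.pure (s.setNat a (i.eval k t s) (e.eval k t s)).tick
  | .setReal a i r, s => PMF.pure (s.setReal a (i.eval k t s) (r.eval k t s)).tick
  | .query a i b, s => PMF.pure (s.setReal a (i.eval k t s) (O (s.nat b))).tick
  | .draw a i e, s =>
      (PMF.uniformOfFintype (Fin (e.eval k t s + 1))).map
        fun v => (s.setNat a (i.eval k t s) (v : ℕ)).tick
  | .seq c₁ c₂, s => (c₁.exec k t O s).bind (c₂.exec k t O)
  | .ite b c₁ c₂, s => if b.Holds k t s then c₁.exec k t O s.tick else c₂.exec k t O s.tick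
  | .loop e c, s => repeatPMF (fun u => c.exec k t O u.tick) (e.eval k t s) s.tick

/-! ### Online execution on a stream of insertions

The stream is an enumeration `x : Fin n ≃ X` of the ground set, so that `x i` is the element that
arrives in time step `i + 1`.  Programs refer to it by the index `i`. -/

section Streams

variable {X : Type*} {n : ℕ}

/-- The set `X_t` of the elements that arrive in the first `t` time steps. -/
def arrived (x : Fin n ≃ X) (t : ℕ) : Finset X :=
  (Finset.univ.filter fun i : Fin n => (i : ℕ) < t).map x.toEmbedding

/-- The set of those elements of `X_t` whose entries in the array `A` are nonzero. -/
def selected (x : Fin n ≃ X) (t : ℕ) (A : ℕ → ℕ) : Finset X :=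
  (Finset.univ.filter fun i : Fin n => (i : ℕ) < t ∧ A i ≠ 0).map x.toEmbedding

/-- One time step: the program is run on the current memory after the `t`-th insertion, with
oracle access to `f` on the subsets of `X_t` only. -/
noncomputable def round (c : Program) (k : ℕ) (x : Fin n ≃ X) (f : Finset X → ℝ) (t : ℕ) :
    State → PMF State :=
  c.exec k t fun A => f (selected x t A)

/-- The distribution of the memory after the first `t` time steps.  The memory is kept from one step
to the next, the random draws are fresh. -/
noncomputable def run (c : Program) (k : ℕ) (x : Fin n ≃ X) (f : Finset X → ℝ) : ℕ → PMF State
  | 0 => PMF.pure State.init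
  | t + 1 => (run c k x f t).bind (round c k x f (t + 1))

/-- The solution `ALG_t`: it is read off from the array of natural numbers with number zero. -/
def solution (x : Fin n ≃ X) (t : ℕ) (s : State) : Finset X := selected x t (s.nat 0)

/-- The expectation `E[f(ALG_t)]`. -/
noncomputable def expectedValue [Fintype X] [DecidableEq X] (c : Program) (k : ℕ) (x : Fin n ≃ X)
    (f : Finset X → ℝ) (t : ℕ) : ℝ :=
  ∑ S : Finset X, (((run c k x f t).map (solution x t)) S).toReal * f S

/-- For all random choices, the solution has at most `k` elements at all times. -/
def IsFeasible (c : Program) (k : ℕ) (x : Fin n ≃ X) (f : Finset X → ℝ) : Prop :=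
  ∀ t ≤ n, ∀ s ∈ (run c k x f t).support, (solution x t s).card ≤ k

/-- For all random choices, `|ALG_t \ ALG_{t-1}| ≤ C` at all times. -/
def IsConsistent [DecidableEq X] (c : Program) (k : ℕ) (x : Fin n ≃ X) (f : Finset X → ℝ)
    (C : ℝ) : Prop :=
  ∀ t < n, ∀ s ∈ (run c k x f t).support, ∀ s' ∈ (round c k x f (t + 1) s).support,
    ((solution x (t + 1) s' \ solution x t s).card : ℝ) ≤ C

/-- `E[f(ALG_t)] ≥ α f(OPT_t)` at all times. -/
def IsApproximation [Fintype X] [DecidableEq X] (c : Program) (k : ℕ) (x : Fin n ≃ X)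
    (f : Finset X → ℝ) (α : ℝ) : Prop :=
  ∀ t ≤ n, α * opt f k (arrived x t) ≤ expectedValue c k x f t

/-- For all random choices and all `t`, the total running time of the first `t` time steps is at
most `p t`. -/
def RunsInTime (c : Program) (k : ℕ) (x : Fin n ≃ X) (f : Finset X → ℝ)
    (p : Polynomial ℕ) : Prop :=
  ∀ t ≤ n, ∀ s ∈ (run c k x f t).support, s.clock ≤ p.eval t

end Streams

end ConsistentSubmodular

/-!
The program recomputes a greedy solution only once in about `k / N` time steps, where `N` is about
`1 / ε`, and at a random phase of this period.  Between two recomputations it keeps every new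
element, so that its target is `S ∪ R` for a greedy solution `S` of size at most `k - k / N` and the
set `R` of all later elements.  Deletions are free, so the solution follows the target by dropping
everything outside it and inserting at most `N ^ 2 + 1` missing elements per step.  The target is
reached about `k / N ^ 2` steps after a recomputation; as the phase is random, the probability of
being in such a period of transition is at most `2 / N` (`card_bad_le`, `Inv.supp_eq_target`).

It remains to choose `S` such that `S ∪ R` is good for every `R` that may come
(`IsGreedyChain.robust`).  For a set `O` of old elements, a greedy solution satisfies
`F (O ∪ S) - F S ≤ F S`, which gives the ratio `1 / 2`.  When this is nearly tight, the gains of the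
greedy algorithm are nearly constant, so `O` is worth hardly more than `S` (`IsGreedyChain.value_le`);
then `R` must be valuable on its own, and `R` adds little to `S`.  In this case a second greedy
solution, computed for the marginal values over `S`, captures half of what `O` adds to `S` and is
nearly independent of `R`.  Playing the second solution with probability `1 / 11` therefore beats the
ratio `1 / 2` by a constant.

All random draws are made in the first time step, so for given draws the run is deterministic.  The
correctness of the program is proved with a Hoare logic for the support of the distribution of
configurations (`Ensures`), on sets of indices rather than elements.
-/

namespace ConsistentSubmodular

/-! ### Submodularity in set form -/

section Submodular

variable {α : Type*} [DecidableEq α] {F : Finset α → ℝ}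

theorem IsMonotone.le_insert (hF : IsMonotone F) (v : α) (S : Finset α) : F S ≤ F (insert v S) := by
  have := hF v S
  simp only [marginal, Finset.singleton_union] at this
  linarith

theorem IsMonotone.le_of_subset (hF : IsMonotone F) {S T : Finset α} (h : S ⊆ T) : F S ≤ F T := by
  have key : ∀ U : Finset α, F S ≤ F (U ∪ S) := by
    intro U
    induction U using Finset.induction_on with
    | empty => simp
    | insert v U _ ih =>
      rw [Finset.insert_union]
      exact ih.trans (hF.le_insert _ _)
  simpa [Finset.union_eq_left.mpr h] using key T

theorem IsSubmodular.insert_le (hS : IsSubmodular F) (hF : IsMonotone F) {S T : Finset α}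
    (h : S ⊆ T) (v : α) : F (insert v T) - F T ≤ F (insert v S) - F S := by
  by_cases hv : v ∈ T
  · rw [Finset.insert_eq_of_mem hv]
    linarith [hF.le_insert v S]
  · simpa [marginal] using hS S T h v hv

theorem IsSubmodular.union_le (hS : IsSubmodular F) (hF : IsMonotone F) {S T : Finset α}
    (h : S ⊆ T) (A : Finset α) : F (A ∪ T) - F T ≤ F (A ∪ S) - F S := by
  induction A using Finset.induction_on with
  | empty => simp
  | insert v A _ ih =>
    rw [Finset.insert_union, Finset.insert_union]
    linarith [hS.insert_le hF (Finset.union_subset_union_right h : A ∪ S ⊆ A ∪ T) v]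

theorem IsSubmodular.union_le_card_mul (hS : IsSubmodular F) (hF : IsMonotone F) {O G : Finset α}
    {δ : ℝ} (h : ∀ v ∈ O, F (insert v G) - F G ≤ δ) : F (O ∪ G) - F G ≤ O.card * δ := by
  induction O using Finset.induction_on with
  | empty => simp
  | insert v O hv ih =>
    rw [Finset.insert_union, Finset.card_insert_of_notMem hv]
    push_cast
    have h1 := ih fun u hu => h u (Finset.mem_insert_of_mem hu)
    have h2 := h v (Finset.mem_insert_self _ _)
    have h3 := hS.insert_le hF (Finset.subset_union_right : G ⊆ O ∪ G) v
    linarith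

/-- The losses of value caused by removing the elements of `O` one at a time from the full set add
up to at most the whole value, so some element loses at most its fair share. -/
theorem IsSubmodular.exists_erase (hS : IsSubmodular F) (hF : IsMonotone F) (h0 : ∀ S, 0 ≤ F S)
    {O : Finset α} (hO : O.Nonempty) (R : Finset α) :
    ∃ v ∈ O, (O.card - 1 : ℝ) * F (O ∪ R) ≤ O.card * F (O.erase v ∪ R) := by
  have key : ∀ A ⊆ O, ∑ v ∈ A, (F (O ∪ R) - F (O.erase v ∪ R)) ≤ F (A ∪ R) - F R := by
    intro A
    induction A using Finset.induction_on with
    | empty => simp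
    | insert v A hv ih =>
      intro hA
      rw [Finset.sum_insert hv, Finset.insert_union]
      have h1 := ih ((Finset.subset_insert _ _).trans hA)
      have hvO : v ∈ O := hA (Finset.mem_insert_self _ _)
      have hsub : A ∪ R ⊆ O.erase v ∪ R := by
        refine Finset.union_subset_union_left fun u hu => Finset.mem_erase.mpr ⟨?_, ?_⟩
        · rintro rfl; exact hv hu
        · exact hA (Finset.mem_insert_of_mem hu)
      have h2 := hS.insert_le hF hsub v
      rw [← Finset.insert_union, Finset.insert_erase hvO] at h2
      linarith
  by_contra! hcon
  have h1 := key O subset_rfl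
  have h2 : ∑ v ∈ O, F (O ∪ R) < ∑ v ∈ O, O.card * (F (O ∪ R) - F (O.erase v ∪ R)) := by
    refine Finset.sum_lt_sum_of_nonempty hO fun v hv => ?_
    have := hcon v hv
    linarith
  rw [← Finset.mul_sum, Finset.sum_const, nsmul_eq_mul] at h2
  have hc : (0 : ℝ) < O.card := by exact_mod_cast hO.card_pos
  have h3 := lt_of_mul_lt_mul_left h2 hc.le
  linarith [h0 R]

/-- Some subset of `O` of size `m` keeps a proportional share of the value, also in the presence
of `R`. -/
theorem IsSubmodular.exists_subset_card (hS : IsSubmodular F) (hF : IsMonotone F)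
    (h0 : ∀ S, 0 ≤ F S) (O R : Finset α) {m : ℕ} (hm : m ≤ O.card) :
    ∃ O' ⊆ O, O'.card = m ∧ (m : ℝ) * F (O ∪ R) ≤ O.card * F (O' ∪ R) := by
  obtain ⟨d, hd⟩ := Nat.exists_eq_add_of_le hm
  induction d generalizing O with
  | zero => exact ⟨O, subset_rfl, by omega, by simp [hd]⟩
  | succ d ih =>
    have hne : O.Nonempty := Finset.card_pos.mp (by omega)
    obtain ⟨v, hv, hval⟩ := hS.exists_erase hF h0 hne R
    have hcard : (O.erase v).card = m + d := by rw [Finset.card_erase_of_mem hv]; omega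
    obtain ⟨O', hsub, hc, hO'⟩ := ih (O.erase v) (by omega) hcard
    refine ⟨O', hsub.trans (Finset.erase_subset _ _), hc, ?_⟩
    rw [hcard] at hO'
    rw [hd] at hval ⊢
    push_cast at hO' hval ⊢
    rcases Nat.eq_zero_or_pos (m + d) with hz | hz
    · have : m = 0 := by omega
      subst this
      have := h0 (O' ∪ R)
      push_cast; simp only [zero_mul]; positivity
    · have hz' : (0 : ℝ) < m + d := by exact_mod_cast hz
      have e1 : (m : ℝ) * ((m + (d + 1) - 1) * F (O ∪ R)) ≤
          m * ((m + (d + 1)) * F (O.erase v ∪ R)) :=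
        mul_le_mul_of_nonneg_left hval (by positivity)
      have e2 : ((m : ℝ) + (d + 1)) * (m * F (O.erase v ∪ R)) ≤
          (m + (d + 1)) * ((m + d) * F (O' ∪ R)) :=
        mul_le_mul_of_nonneg_left hO' (by positivity)
      refine le_of_mul_le_mul_left ?_ hz'
      linarith

end Submodular

/-! ### Greedy chains and robustness to insertions -/

section Greedy

variable {α : Type*} [DecidableEq α] {F : Finset α → ℝ}

/-- `G 0, …, G j` is a run of the greedy algorithm on the ground set `V`, started from `G 0`: each
set arises from its predecessor by inserting an element of `V` of largest value.  Elements already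
present may be inserted again. -/
structure IsGreedyChain (F : Finset α → ℝ) (V : Finset α) (j : ℕ) (G : ℕ → Finset α) :
    Prop where
  step : ∀ i < j, ∃ v ∈ V, G (i + 1) = insert v (G i)
  best : ∀ i < j, ∀ v ∈ V, F (insert v (G i)) ≤ F (G (i + 1))

namespace IsGreedyChain

variable {V : Finset α} {j : ℕ} {G : ℕ → Finset α}

theorem subset (hG : IsGreedyChain F V j G) {i i' : ℕ} (h : i ≤ i') (h' : i' ≤ j) :
    G i ⊆ G i' := by
  induction i', h using Nat.le_induction with
  | base => exact subset_rfl
  | succ i' h ih =>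
    obtain ⟨v, -, hv⟩ := hG.step i' (by omega)
    exact (ih (by omega)).trans (hv ▸ Finset.subset_insert _ _)

theorem gain_antitone (hG : IsGreedyChain F V j G) (hF : IsMonotone F) (hS : IsSubmodular F)
    {i i' : ℕ} (h : i ≤ i') (h' : i' < j) : F (G (i' + 1)) - F (G i') ≤ F (G (i + 1)) - F (G i) := by
  obtain ⟨v, hv, hvG⟩ := hG.step i' h'
  have h1 := hS.insert_le hF (hG.subset h h'.le) v
  have h2 := hG.best i (by omega) v hv
  rw [hvG]
  linarith

theorem union_sub_le (hG : IsGreedyChain F V j G) (hF : IsMonotone F) (hS : IsSubmodular F)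
    {O : Finset α} (hO : O ⊆ V) (hj : O.card ≤ j) {i : ℕ} (hi : i < j) :
    F (O ∪ G i) - F (G i) ≤ j * (F (G (i + 1)) - F (G i)) := by
  have h0 : 0 ≤ F (G (i + 1)) - F (G i) := by
    linarith [hF.le_of_subset (hG.subset (Nat.le_succ i) hi)]
  refine (hS.union_le_card_mul hF fun v hv => ?_).trans
    (mul_le_mul_of_nonneg_right (Nat.cast_le.mpr hj) h0)
  linarith [hG.best i hi v (hO hv)]

theorem mul_gain_le (hG : IsGreedyChain F V j G) (hF : IsMonotone F) (hS : IsSubmodular F)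
    {i i' : ℕ} (h : i ≤ i' + 1) (h' : i' < j) :
    i * (F (G (i' + 1)) - F (G i')) ≤ F (G i) - F (G 0) := by
  induction i with
  | zero => simp
  | succ i ih =>
    have h1 := ih (by omega)
    have h2 := hG.gain_antitone hF hS (show i ≤ i' by omega) h'
    push_cast
    linarith

/-- The gains are nonincreasing and the last one bounds every remaining marginal value. -/
theorem union_sub_le_sub (hG : IsGreedyChain F V j G) (hF : IsMonotone F) (hS : IsSubmodular F)
    {O : Finset α} (hO : O ⊆ V) (hj : O.card ≤ j) :
    F (O ∪ G j) - F (G j) ≤ F (G j) - F (G 0) := by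
  rcases j with _ | j
  · have : O = ∅ := Finset.card_eq_zero.mp (by omega)
    simp [this]
  · have h1 := hG.union_sub_le hF hS hO hj (Nat.lt_succ_self j)
    have h2 := hG.mul_gain_le hF hS (le_refl (j + 1)) (Nat.lt_succ_self j)
    have h3 := hS.union_le hF (hG.subset (Nat.le_succ j) le_rfl) O
    linarith

/-- If much of the value of `O` is missing from the greedy solution, then the gains of the greedy
algorithm are almost constant, so that `O` is worth little more than the greedy solution. -/
theorem value_le (hG : IsGreedyChain F V j G) (hF : IsMonotone F) (hS : IsSubmodular F)
    (h0 : ∀ S, 0 ≤ F S) {O : Finset α} (hO : O ⊆ V) (hj : O.card ≤ j) (hpos : 0 < j) :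
    F O ≤ 5 * F (G j) - 15 / 4 * (F (O ∪ G j) - F (G j)) := by
  -- Let `s` be the value after a quarter of the steps, interpolated linearly between `G i` and
  -- `G (i + 1)`.  Then `F O ≤ s + j * δ` and `j * δ ≤ 4 * s`, while the remaining three quarters of
  -- the steps gain at least `c / j` each.
  set i := j / 4 with hi
  have hij : i < j := by omega
  set c := F (O ∪ G j) - F (G j) with hc
  set δ := F (G (i + 1)) - F (G i) with hδ
  have hj' : (0 : ℝ) < j := by exact_mod_cast hpos
  have hcδ : ∀ l < j, c / j ≤ F (G (l + 1)) - F (G l) := by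
    intro l hl
    rw [div_le_iff₀ hj']
    have h1 := hG.union_sub_le hF hS hO hj hl
    have h2 := hS.union_le hF (hG.subset hl.le le_rfl) O
    linarith
  have htail : ∀ l, i + 1 ≤ l → l ≤ j →
      ((l : ℝ) - (i + 1)) * (c / j) ≤ F (G l) - F (G (i + 1)) := by
    intro l hl
    induction l, hl using Nat.le_induction with
    | base => simp
    | succ l hl ih =>
      intro hlj
      have h1 := ih (by omega)
      have h2 := hcδ l (by omega)
      push_cast
      linarith
  have e1 := htail j hij le_rfl
  have e2 : F O ≤ F (G i) + j * δ := by
    have h1 := hG.union_sub_le hF hS hO hj hij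
    have h2 := hF.le_of_subset (Finset.subset_union_left : O ⊆ O ∪ G i)
    linarith
  have e3 : i * δ ≤ F (G i) := by
    have := hG.mul_gain_le hF hS (Nat.le_succ i) hij
    linarith [h0 (G 0)]
  have e4 := hcδ i hij
  have hi1 : (i : ℝ) ≤ j / 4 := by
    have : ((4 * i : ℕ) : ℝ) ≤ j := by exact_mod_cast (by omega : 4 * i ≤ j)
    push_cast at this
    linarith
  have hi2 : (j : ℝ) / 4 ≤ i + 1 := by
    have : (j : ℝ) ≤ ((4 * i + 4 : ℕ) : ℝ) := by exact_mod_cast (by omega : j ≤ 4 * i + 4)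
    push_cast at this
    linarith
  set s := F (G i) + ((j : ℝ) / 4 - i) * δ with hs
  have hδ0 : 0 ≤ δ := by
    have := hF.le_of_subset (hG.subset (Nat.le_succ i) hij)
    linarith
  have f1 : F O ≤ 5 * s := by
    have : 0 ≤ ((j : ℝ) / 4 - i) * δ := mul_nonneg (by linarith) hδ0
    linarith
  have f2 : s + 3 / 4 * c ≤ F (G j) := by
    have h1 : ((i : ℝ) + 1 - j / 4) * (c / j) ≤ (i + 1 - j / 4) * δ :=
      mul_le_mul_of_nonneg_left e4 (by linarith)
    have h2 : (j : ℝ) * (c / j) = c := by field_simp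
    linarith
  linarith

/-- **Robustness.**  Let `S = G j` be a greedy solution and let `H` continue the greedy algorithm
from `S`.  Playing `H j \ S` with probability `1 / 11` and `S` otherwise is good against every
later insertion of a set `R`. -/
theorem robust {H : ℕ → Finset α} (hG : IsGreedyChain F V j G) (hH : IsGreedyChain F V j H)
    (hGH : H 0 = G j) (hF : IsMonotone F) (hS : IsSubmodular F) (h0 : ∀ S, 0 ≤ F S)
    {O : Finset α} (hO : O ⊆ V) (hj : O.card ≤ j) (R : Finset α) :
    51 / 100 * F (O ∪ R) ≤ 1 / 11 * F ((H j \ G j) ∪ R) + 10 / 11 * F (G j ∪ R) := by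
  rcases Nat.eq_zero_or_pos j with hz | hpos
  · have hO' : O = ∅ := Finset.card_eq_zero.mp (by omega)
    have h1 := hF.le_of_subset (Finset.subset_union_right : R ⊆ (H j \ G j) ∪ R)
    have h2 := hF.le_of_subset (Finset.subset_union_right : R ⊆ G j ∪ R)
    rw [hO', Finset.empty_union]
    linarith [h0 R]
  · have hsub : G j ⊆ H j := hGH ▸ hH.subset (Nat.zero_le j) le_rfl
    have a1 := hG.value_le hF hS h0 hO hj hpos
    have a2 := hG.union_sub_le_sub hF hS hO hj
    have a3 := hH.union_sub_le_sub hF hS hO hj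
    rw [hGH] at a3
    have a4 := hF.le_of_subset (Finset.union_subset_union_right hsub : O ∪ G j ⊆ O ∪ H j)
    have a5 : F (O ∪ R) ≤ F O + F R := by
      have := hS.union_le hF (Finset.empty_subset R) O
      rw [Finset.union_empty] at this
      linarith [h0 ∅]
    have a6 : F (O ∪ R) ≤ F (G j ∪ R) + (F (O ∪ G j) - F (G j)) := by
      have h1 := hS.union_le hF (Finset.subset_union_left : G j ⊆ G j ∪ R) O
      have h2 := hF.le_of_subset
        (Finset.union_subset_union_right Finset.subset_union_right : O ∪ R ⊆ O ∪ (G j ∪ R))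
      linarith
    have a7 := hF.le_of_subset (Finset.subset_union_left : G j ⊆ G j ∪ R)
    have a8 : F R + (F (H j) - F (G j ∪ R)) ≤ F ((H j \ G j) ∪ R) := by
      have h1 := hS.union_le hF (Finset.subset_union_right : R ⊆ G j ∪ R) (H j \ G j)
      have h2 : F (H j) ≤ F ((H j \ G j) ∪ (G j ∪ R)) := by
        refine hF.le_of_subset ?_
        rw [← Finset.union_assoc, Finset.sdiff_union_of_subset hsub]
        exact Finset.subset_union_left
      linarith
    have a9 := h0 (G 0)
    have a10 := h0 (O ∪ R)
    -- A linear combination of the above; every probability between `2 / 25` and `4 / 41` would do in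
    -- place of `1 / 11`.
    linarith

end IsGreedyChain

end Greedy


/-! ### Reasoning about programs -/

/-- Every final configuration of `c` that is reached from `s` with positive probability satisfies
`Q`. -/
def Ensures (k t : ℕ) (O : (ℕ → ℕ) → ℝ) (c : Program) (s : State) (Q : State → Prop) : Prop :=
  ∀ s' ∈ (c.exec k t O s).support, Q s'

section Rules

variable {k t : ℕ} {O : (ℕ → ℕ) → ℝ} {s : State} {Q Q' : State → Prop} {c c₁ c₂ : Program}

theorem Ensures.mono (h : Ensures k t O c s Q) (hQ : ∀ u, Q u → Q' u) : Ensures k t O c s Q' :=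
  fun s' hs' => hQ s' (h s' hs')

theorem Ensures.and (h : Ensures k t O c s Q) (h' : Ensures k t O c s Q') :
    Ensures k t O c s fun u => Q u ∧ Q' u :=
  fun s' hs' => ⟨h s' hs', h' s' hs'⟩

theorem ensures_skip : Ensures k t O .skip s Q ↔ Q s.tick := by
  simp [Ensures, Program.exec]

theorem ensures_setNat {a : ℕ} {i e : NatTerm} :
    Ensures k t O (.setNat a i e) s Q ↔ Q (s.setNat a (i.eval k t s) (e.eval k t s)).tick := by
  simp [Ensures, Program.exec]

theorem ensures_setReal {a : ℕ} {i : NatTerm} {r : RealTerm} :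
    Ensures k t O (.setReal a i r) s Q ↔ Q (s.setReal a (i.eval k t s) (r.eval k t s)).tick := by
  simp [Ensures, Program.exec]

theorem ensures_query {a b : ℕ} {i : NatTerm} :
    Ensures k t O (.query a i b) s Q ↔ Q (s.setReal a (i.eval k t s) (O (s.nat b))).tick := by
  simp [Ensures, Program.exec]

/-- In the definition of `Program.exec` the uniform distribution is first mapped to `ℕ`. -/
theorem exec_draw {a : ℕ} {i e : NatTerm} :
    (Program.draw a i e).exec k t O s = (PMF.uniformOfFintype (Fin (e.eval k t s + 1))).bind
      fun v => PMF.pure (s.setNat a (i.eval k t s) v).tick := by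
  change PMF.map _ (PMF.bind _ fun v : Fin (e.eval k t s + 1) => PMF.pure (v : ℕ)) = _
  rw [PMF.map_bind]
  simp only [PMF.pure_map]

theorem ensures_draw {a : ℕ} {i e : NatTerm} :
    Ensures k t O (.draw a i e) s Q ↔
      ∀ v : Fin (e.eval k t s + 1), Q (s.setNat a (i.eval k t s) v).tick := by
  simp [Ensures, exec_draw]

theorem exec_seq : (Program.seq c₁ c₂).exec k t O s = (c₁.exec k t O s).bind (c₂.exec k t O) := by
  rw [Program.exec]

theorem exec_ite_of_holds {b : Test} (h : b.Holds k t s) :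
    (Program.ite b c₁ c₂).exec k t O s = c₁.exec k t O s.tick := by
  rw [Program.exec, if_pos h]

theorem ensures_seq :
    Ensures k t O (.seq c₁ c₂) s Q ↔ Ensures k t O c₁ s fun u => Ensures k t O c₂ u Q := by
  simp only [Ensures, Program.exec, PMF.mem_support_bind_iff]
  exact ⟨fun h u hu v hv => h v ⟨u, hu, hv⟩, fun h v ⟨u, hu, hv⟩ => h u hu v hv⟩

theorem ensures_ite {b : Test} :
    Ensures k t O (.ite b c₁ c₂) s Q ↔
      (b.Holds k t s → Ensures k t O c₁ s.tick Q) ∧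
        (¬ b.Holds k t s → Ensures k t O c₂ s.tick Q) := by
  by_cases h : b.Holds k t s <;> simp [Ensures, Program.exec, h]

/-- The rule for counted loops, with an invariant `I` indexed by the number of iterations. -/
theorem ensures_loop {e : NatTerm} (I : ℕ → State → Prop) (h0 : I 0 s.tick)
    (hstep : ∀ j < e.eval k t s, ∀ u, I j u → Ensures k t O c u.tick (I (j + 1)))
    (hQ : ∀ u, I (e.eval k t s) u → Q u) : Ensures k t O (.loop e c) s Q := by
  have key : ∀ n j u, j + n = e.eval k t s → I j u →
      ∀ v ∈ (repeatPMF (fun u => c.exec k t O u.tick) n u).support, I (e.eval k t s) v := by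
    intro n
    induction n with
    | zero =>
      intro j u hj hu v hv
      obtain rfl : v = u := by simpa [repeatPMF] using hv
      simpa [← hj] using hu
    | succ n ih =>
      intro j u hj hu v hv
      simp only [repeatPMF, PMF.mem_support_bind_iff] at hv
      obtain ⟨w, hw, hv⟩ := hv
      exact ih (j + 1) w (by omega) (hstep j (by omega) u hu w hw) v hv
  exact fun v hv => hQ v (key _ 0 _ (by omega) h0 v hv)

/-- The arrays of natural numbers to which a program may write. -/
def Program.writes : Program → Finset ℕ
  | .skip => ∅
  | .setNat a _ _ => {a}
  | .setReal _ _ _ => ∅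
  | .query _ _ _ => ∅
  | .draw a _ _ => {a}
  | .seq c₁ c₂ => c₁.writes ∪ c₂.writes
  | .ite _ c₁ c₂ => c₁.writes ∪ c₂.writes
  | .loop _ c => c.writes

theorem ensures_frame (c : Program) (s : State) :
    Ensures k t O c s fun u => ∀ a, a ∉ c.writes → u.nat a = s.nat a := by
  induction c generalizing s with
  | skip => simp [ensures_skip, State.tick]
  | setNat a i e =>
    simp +contextual [ensures_setNat, State.tick, State.setNat, Program.writes]
  | setReal a i r => simp [ensures_setReal, State.tick, State.setReal]
  | query a i b => simp [ensures_query, State.tick, State.setReal]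
  | draw a i e =>
    simp +contextual [ensures_draw, State.tick, State.setNat, Program.writes]
  | seq c₁ c₂ ih₁ ih₂ =>
    rw [ensures_seq]
    refine (ih₁ s).mono fun u hu => (ih₂ u).mono fun v hv a ha => ?_
    simp only [Program.writes, Finset.mem_union, not_or] at ha
    rw [hv a ha.2, hu a ha.1]
  | ite b c₁ c₂ ih₁ ih₂ =>
    rw [ensures_ite]
    refine ⟨fun _ => (ih₁ s.tick).mono fun u hu a ha => ?_,
      fun _ => (ih₂ s.tick).mono fun u hu a ha => ?_⟩ <;>
    simp only [Program.writes, Finset.mem_union, not_or] at ha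
    · exact hu a ha.1
    · exact hu a ha.2
  | loop e c ih =>
    refine ensures_loop (fun _ u => ∀ a, a ∉ (Program.loop e c).writes → u.nat a = s.nat a)
      (fun _ _ => rfl) (fun j _ u hu => (ih u.tick).mono fun v hv a ha => ?_) fun u hu => hu
    rw [hv a ha]
    exact hu a ha

/-- All loops of the program run once for each arrived element. -/
def Program.LoopsOverArrivals : Program → Prop
  | .seq c₁ c₂ => c₁.LoopsOverArrivals ∧ c₂.LoopsOverArrivals
  | .ite _ c₁ c₂ => c₁.LoopsOverArrivals ∧ c₂.LoopsOverArrivals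
  | .loop e c => e = .arrivals ∧ c.LoopsOverArrivals
  | _ => True

/-- A bound, as a polynomial in the number of arrivals, on the running time of a program all of
whose loops run once for each arrived element. -/
noncomputable def Program.timeBound : Program → Polynomial ℕ
  | .seq c₁ c₂ => c₁.timeBound + c₂.timeBound
  | .ite _ c₁ c₂ => 1 + c₁.timeBound + c₂.timeBound
  | .loop _ c => 1 + Polynomial.X * (1 + c.timeBound)
  | _ => 1

theorem ensures_clock (c : Program) (hc : c.LoopsOverArrivals) (s : State) :
    Ensures k t O c s fun u => u.clock ≤ s.clock + c.timeBound.eval t := by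
  induction c generalizing s with
  | skip => simp [ensures_skip, State.tick, Program.timeBound]
  | setNat a i e => simp [ensures_setNat, State.tick, State.setNat, Program.timeBound]
  | setReal a i r => simp [ensures_setReal, State.tick, State.setReal, Program.timeBound]
  | query a i b => simp [ensures_query, State.tick, State.setReal, Program.timeBound]
  | draw a i e => simp [ensures_draw, State.tick, State.setNat, Program.timeBound]
  | seq c₁ c₂ ih₁ ih₂ =>
    rw [ensures_seq]
    refine (ih₁ hc.1 s).mono fun u hu => (ih₂ hc.2 u).mono fun v hv => ?_
    simp only [Program.timeBound, Polynomial.eval_add]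
    omega
  | ite b c₁ c₂ ih₁ ih₂ =>
    rw [ensures_ite]
    simp only [Program.timeBound, Polynomial.eval_add, Polynomial.eval_one]
    refine ⟨fun _ => (ih₁ hc.1 s.tick).mono fun u hu => ?_,
      fun _ => (ih₂ hc.2 s.tick).mono fun u hu => ?_⟩ <;>
    · simp only [State.tick] at hu
      omega
  | loop e c ih =>
    obtain ⟨rfl, hc⟩ := hc
    refine ensures_loop (fun j u => u.clock ≤ s.clock + 1 + j * (1 + c.timeBound.eval t))
      (by simp [State.tick]) (fun j _ u hu => (ih hc u.tick).mono fun v hv => ?_) fun u hu => ?_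
    · simp only [State.tick] at hv
      rw [add_mul]
      omega
    · simp only [Program.timeBound, Polynomial.eval_add, Polynomial.eval_one, Polynomial.eval_mul,
        Polynomial.eval_X]
      simp only [NatTerm.eval] at hu
      omega

end Rules

/-! ### The program -/

/-- Scalar variables live in cell `0` of an array of their own.  Arrays `0`, `1` and `2` hold the
solution, its target and the current greedy set; the scalars `3`, …, `8` are the phase, the coin, the
loop index, the index of the best element, a counter and an auxiliary copy. -/
def scalar (a : ℕ) : NatTerm := .get a (.lit 0)

/-- The entry of array `a` at the loop index, which is kept in array `5`. -/
def entry (a : ℕ) : NatTerm := .get a (scalar 5)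

def assign (a : ℕ) (e : NatTerm) : Program := .setNat a (.lit 0) e

/-- The term `n * e`, written as a sum because programs cannot multiply. -/
def NatTerm.times : ℕ → NatTerm → NatTerm
  | 0, _ => .lit 0
  | n + 1, e => .add (times n e) e

/-- Run `c` for every arrived element; the loop index is the scalar `5`. -/
def forEach (c : Program) : Program :=
  .seq (assign 5 (.lit 0)) (.loop .arrivals (.seq c (assign 5 (.add (scalar 5) (.lit 1)))))

/-- Compare the value of the set in array `2` together with the element at the loop index to the
best value seen so far, which is kept with its index in real cell `0` and scalar `6`. -/
def scanBody : Program :=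
  .seq (assign 8 (entry 2)) <|
  .seq (.setNat 2 (scalar 5) (.lit 1)) <|
  .seq (.query 0 (.lit 1) 2) <|
  .seq (.setNat 2 (scalar 5) (scalar 8)) <|
  .ite (.realLE (.get 0 (.lit 1)) (.get 0 (.lit 0))) .skip <|
  .seq (.setReal 0 (.lit 0) (.get 0 (.lit 1))) (assign 6 (scalar 5))

/-- Insert a best element into the set in array `2` and count it in scalar `7`. -/
def greedyStepProgram : Program :=
  .seq (assign 6 (.lit 0)) <|
  .seq (.query 0 (.lit 0) 2) <|
  .seq (forEach scanBody) <|
  .seq (.setNat 2 (scalar 6) (.lit 1)) <|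
  assign 7 (.add (scalar 7) (.lit 1))

/-- At most `k - k / N` greedy steps on the set in array `2`.  The test says that the number of steps
made so far is below `k - k / N`; it avoids a division. -/
def greedyProgram (N : ℕ) : Program :=
  .seq (assign 7 (.lit 0)) <|
  .loop .arrivals <|
  .ite (.natLE (.add .bound (.lit 1)) (.times N (.sub .bound (scalar 7)))) greedyStepProgram .skip

/-- Set the target in array `1` to the first greedy solution if the coin in scalar `4` is positive,
and to the second greedy solution otherwise. -/
def rebaseProgram (N : ℕ) : Program :=
  .seq (forEach (.setNat 2 (scalar 5) (.lit 0))) <|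
  .seq (greedyProgram N) <|
  .seq (forEach (.setNat 1 (scalar 5) (entry 2))) <|
  .ite (.natLE (scalar 4) (.lit 0))
    (.seq (greedyProgram N) <| forEach <| .ite (.natLE (entry 1) (.lit 0))
      (.setNat 1 (scalar 5) (entry 2)) (.setNat 1 (scalar 5) (.lit 0)))
    .skip

/-- Remove from the solution in array `0` all elements outside the target and insert up to `C`
missing elements of the target. -/
def updateProgram (C : ℕ) : Program :=
  .seq (assign 7 (.lit 0)) <|
  forEach <| .ite (.natLE (entry 1) (.lit 0)) (.setNat 0 (scalar 5) (.lit 0)) <|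
    .ite (.and (.natLE (entry 0) (.lit 0)) (.natLE (.add (scalar 7) (.lit 1)) (.lit C)))
      (.seq (.setNat 0 (scalar 5) (.lit 1)) (assign 7 (.add (scalar 7) (.lit 1))))
      .skip

/-- One time step without the initial random draws.  The phase in scalar `3` advances by `N`; whenever
it exceeds `k` it drops by `k + 1` and the target is computed anew, and otherwise the new element
joins the target. -/
def stepProgram (N : ℕ) : Program :=
  .seq (assign 3 (.add (scalar 3) (.lit N))) <|
  .seq (.ite (.natLE (.add .bound (.lit 1)) (scalar 3))
    (.seq (assign 3 (.sub (scalar 3) (.add .bound (.lit 1)))) (rebaseProgram N))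
    (.setNat 1 (.sub .arrivals (.lit 1)) (.lit 1))) <|
  updateProgram (N ^ 2 + 1)

/-- At the first arrival, draw the phase from `{0, …, k}` and the coin from `{0, …, 10}`. -/
def initProgram : Program :=
  .ite (.natLE .arrivals (.lit 1))
    (.seq (.draw 3 (.lit 0) .bound) (.draw 4 (.lit 0) (.lit 10))) .skip

def mainProgram (N : ℕ) : Program := .seq initProgram (stepProgram N)

theorem mainProgram_loopsOverArrivals (N : ℕ) : (mainProgram N).LoopsOverArrivals := by
  simp [mainProgram, initProgram, stepProgram, updateProgram, rebaseProgram, greedyProgram,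
    greedyStepProgram, scanBody, forEach, assign, Program.LoopsOverArrivals]

theorem NatTerm.eval_times (k t : ℕ) (s : State) (n : ℕ) (e : NatTerm) :
    (NatTerm.times n e).eval k t s = n * e.eval k t s := by
  induction n with
  | zero => simp [times, eval]
  | succ n ih => simp [times, eval, ih, add_mul]

/-! ### The sets computed by the program -/

/-- The set described by the first `t` entries of an array. -/
def supp (t : ℕ) (A : ℕ → ℕ) : Finset ℕ := (Finset.range t).filter fun i => A i ≠ 0

theorem mem_supp {t : ℕ} {A : ℕ → ℕ} {i : ℕ} : i ∈ supp t A ↔ i < t ∧ A i ≠ 0 := by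
  simp [supp]

theorem supp_congr {t : ℕ} {A B : ℕ → ℕ} (h : ∀ i < t, A i = B i) : supp t A = supp t B := by
  ext i
  simp only [mem_supp]
  exact and_congr_right fun hi => by rw [h i hi]

theorem supp_update_one {t j : ℕ} (A : ℕ → ℕ) (hj : j < t) :
    supp t (Function.update A j 1) = insert j (supp t A) := by
  ext i
  by_cases h : i = j
  · simp [mem_supp, h, hj]
  · simp [mem_supp, h]

section Greedy

variable (F : Finset ℕ → ℝ)

/-- The best value among `F G` and the values `F (insert v G)` with `v < j`, and the first `v` at
which it is attained, or `0` if no insertion raises the value. -/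
noncomputable def scanBest (G : Finset ℕ) : ℕ → ℝ × ℕ
  | 0 => (F G, 0)
  | j + 1 => if F (insert j G) ≤ (scanBest G j).1 then scanBest G j else (F (insert j G), j)

/-- Insert the element found by `scanBest`.  If no insertion raises the value, this is the element
`0`, which does no harm by monotonicity. -/
noncomputable def greedyStep (t : ℕ) (G : Finset ℕ) : Finset ℕ := insert (scanBest F G t).2 G

/-- The result of `j` greedy steps on the ground set `{0, …, t - 1}`, starting from `G`. -/
noncomputable def greedy (t : ℕ) (G : Finset ℕ) (j : ℕ) : Finset ℕ := (greedyStep F t)^[j] G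

/-- The first greedy solution if `w` is positive, and the second one otherwise. -/
noncomputable def baseSet (N k t w : ℕ) : Finset ℕ :=
  let S := greedy F t ∅ (min t (k - k / N))
  if w = 0 then greedy F t S (min t (k - k / N)) \ S else S

theorem greedy_succ (t : ℕ) (G : Finset ℕ) (j : ℕ) :
    greedy F t G (j + 1) = greedyStep F t (greedy F t G j) := by
  simp only [greedy, Function.iterate_succ_apply']

theorem scanBest_spec (G : Finset ℕ) (t : ℕ) :
    ((scanBest F G t).1 = F G ∧ (scanBest F G t).2 = 0 ∨
      (scanBest F G t).2 < t ∧ (scanBest F G t).1 = F (insert (scanBest F G t).2 G)) ∧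
    F G ≤ (scanBest F G t).1 ∧ ∀ v < t, F (insert v G) ≤ (scanBest F G t).1 := by
  induction t with
  | zero => simp [scanBest]
  | succ t ih =>
    obtain ⟨h1, h2, h3⟩ := ih
    rw [scanBest]
    split_ifs with h
    · refine ⟨h1.imp_right fun h => ⟨by omega, h.2⟩, h2, fun v hv => ?_⟩
      rcases Nat.lt_succ_iff_lt_or_eq.mp hv with hv | rfl
      exacts [h3 v hv, h]
    · push Not at h
      refine ⟨.inr ⟨by simp, rfl⟩, h2.trans h.le, fun v hv => ?_⟩
      rcases Nat.lt_succ_iff_lt_or_eq.mp hv with hv | rfl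
      exacts [(h3 v hv).trans h.le, le_rfl]

theorem scanBest_lt (G : Finset ℕ) {t : ℕ} (ht : 0 < t) : (scanBest F G t).2 < t := by
  rcases (scanBest_spec F G t).1 with h | h <;> omega

variable {F}

theorem le_greedyStep (hF : IsMonotone F) (t : ℕ) (G : Finset ℕ) {v : ℕ} (hv : v < t) :
    F (insert v G) ≤ F (greedyStep F t G) := by
  obtain ⟨h1, -, h3⟩ := scanBest_spec F G t
  refine (h3 v hv).trans ?_
  rcases h1 with h | h
  · rw [h.1]; exact hF.le_insert _ _
  · exact h.2.le

theorem isGreedyChain_greedy (hF : IsMonotone F) {t j : ℕ} (hj : j ≤ t) (G : Finset ℕ) :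
    IsGreedyChain F (Finset.range t) j (greedy F t G) where
  step i hi := ⟨(scanBest F (greedy F t G i) t).2,
    Finset.mem_range.mpr (scanBest_lt F _ (by omega)), greedy_succ F t G i⟩
  best i hi v hv := by
    rw [greedy_succ]
    exact le_greedyStep hF t _ (Finset.mem_range.mp hv)

variable (F)

theorem greedy_subset_range {t j : ℕ} (hj : j ≤ t) {G : Finset ℕ} (hG : G ⊆ Finset.range t) :
    greedy F t G j ⊆ Finset.range t := by
  induction j with
  | zero => exact hG
  | succ j ih =>
    rw [greedy_succ]
    exact Finset.insert_subset (Finset.mem_range.mpr (scanBest_lt F _ (by omega))) (ih (by omega))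

theorem card_greedy_sdiff_le (t j : ℕ) (G : Finset ℕ) : (greedy F t G j \ G).card ≤ j := by
  induction j with
  | zero => simp [greedy]
  | succ j ih =>
    rw [greedy_succ, greedyStep]
    refine (Finset.card_le_card ?_).trans ((Finset.card_insert_le (scanBest F (greedy F t G j) t).2
      (greedy F t G j \ G)).trans (Nat.succ_le_succ ih))
    intro v
    simp only [Finset.mem_sdiff, Finset.mem_insert]
    tauto

theorem card_baseSet_le (N k t w : ℕ) : (baseSet F N k t w).card ≤ k - k / N := by
  rw [baseSet]
  split_ifs
  · exact (card_greedy_sdiff_le F _ _ _).trans (min_le_right _ _)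
  · have := card_greedy_sdiff_le F t (min t (k - k / N)) ∅
    rw [Finset.sdiff_empty] at this
    exact this.trans (min_le_right _ _)

theorem baseSet_subset_range (N k t w : ℕ) : baseSet F N k t w ⊆ Finset.range t := by
  have h := greedy_subset_range F (min_le_left t (k - k / N)) (Finset.empty_subset (Finset.range t))
  rw [baseSet]
  split_ifs
  · exact Finset.sdiff_subset.trans (greedy_subset_range F (min_le_left _ _) h)
  · exact h

end Greedy


/-! ### Correctness of one time step -/

section Correctness

variable {k t : ℕ} {O : (ℕ → ℕ) → ℝ} {s : State} {Q : State → Prop}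

/-- The rule for loops over the arrived elements.  The invariant is insensitive to the clock and to
the loop index, and everything that the body does not write to is known to be unchanged. -/
theorem ensures_forEach {c : Program} (h5 : 5 ∉ c.writes) (I : ℕ → State → Prop)
    (hI : ∀ j u v, (∀ a ≠ 5, v.nat a = u.nat a) → v.real = u.real → I j u → I j v)
    (h0 : I 0 s)
    (hstep : ∀ j < t, ∀ u, (∀ a ≠ 5, a ∉ c.writes → u.nat a = s.nat a) → u.nat 5 0 = j → I j u →
      Ensures k t O c u (I (j + 1)))
    (hQ : ∀ u, I t u → Q u) : Ensures k t O (forEach c) s Q := by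
  rw [forEach, ensures_seq, assign, ensures_setNat]
  refine ensures_loop
    (fun j u => (∀ a ≠ 5, a ∉ c.writes → u.nat a = s.nat a) ∧ u.nat 5 0 = j ∧ I j u)
    ⟨?_, ?_, hI _ s _ ?_ ?_ h0⟩ (fun j hj u hu => ?_) fun u hu => hQ u hu.2.2
  · intro a ha _
    simp [State.tick, State.setNat, ha]
  · simp [State.tick, State.setNat, NatTerm.eval]
  · intro a ha
    simp [State.tick, State.setNat, ha]
  · simp [State.tick, State.setNat]
  · rw [ensures_seq]
    obtain ⟨hfr, hj5, hIu⟩ := hu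
    refine ((hstep j hj u.tick hfr hj5 (hI j u _ (fun _ _ => rfl) rfl hIu)).and
      (ensures_frame c u.tick)).mono fun v hv => ?_
    obtain ⟨hv1, hv2⟩ := hv
    rw [assign, ensures_setNat]
    refine ⟨?_, ?_, hI _ v _ ?_ ?_ hv1⟩
    · intro a ha hac
      simp only [State.tick, State.setNat, Function.update_of_ne ha, hv2 a hac]
      exact hfr a ha hac
    · have := hv2 5 h5
      simp only [State.tick] at this
      simp [State.tick, State.setNat, NatTerm.eval, scalar, this, hj5]
    · intro a ha
      simp [State.tick, State.setNat, ha]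
    · simp [State.tick, State.setNat]

variable {F : Finset ℕ → ℝ}

theorem ensures_greedyStepProgram (hO : ∀ A, O A = F (supp t A)) (ht : 0 < t) {G : Finset ℕ}
    (hG : supp t (s.nat 2) = G) :
    Ensures k t O greedyStepProgram s fun u =>
      supp t (u.nat 2) = greedyStep F t G ∧ u.nat 7 0 = s.nat 7 0 + 1 := by
  rw [greedyStepProgram, ensures_seq, assign, ensures_setNat, ensures_seq, ensures_query,
    ensures_seq]
  refine ensures_forEach (by simp [scanBody, assign, Program.writes])
    (fun j u => supp t (u.nat 2) = G ∧ u.nat 7 0 = s.nat 7 0 ∧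
      u.real 0 0 = (scanBest F G j).1 ∧ u.nat 6 0 = (scanBest F G j).2) ?_ ?_ ?_ ?_
  · rintro j u v hn hr ⟨h1, h2, h3, h4⟩
    rw [hn 2 (by simp), hn 7 (by simp), hn 6 (by simp), hr]
    exact ⟨h1, h2, h3, h4⟩
  · simp [State.tick, State.setNat, State.setReal, NatTerm.eval, scanBest, hO, hG]
  · rintro j hj u - h5 ⟨h1, h2, h3, h4⟩
    have hu : supp t (Function.update (u.nat 2) j 1) = insert j G := by
      rw [supp_update_one _ hj, h1]
    simp only [scanBody, assign, ensures_seq, ensures_setNat, ensures_query, ensures_ite,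
      ensures_skip, ensures_setReal, Test.Holds, RealTerm.eval, NatTerm.eval, State.tick,
      State.setNat, State.setReal, scalar, entry, scanBest]
    simp [h5, hO, hu, h1, h2, h3, h4]
    grind
  · rintro u ⟨h1, h2, -, h4⟩
    simp [ensures_seq, assign, ensures_setNat, State.tick, State.setNat, NatTerm.eval, scalar, h4,
      h2, supp_update_one _ (scanBest_lt F G ht), h1, greedyStep]

theorem guard_iff {N n : ℕ} (hN : 0 < N) : k + 1 ≤ N * (k - n) ↔ n < k - k / N := by
  have h : k / N < k - n ↔ k < N * (k - n) := by
    rw [Nat.div_lt_iff_lt_mul hN, mul_comm]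
  generalize k / N = q at *
  omega

theorem ensures_greedyProgram {N : ℕ} (hN : 0 < N) (hO : ∀ A, O A = F (supp t A)) {G : Finset ℕ}
    (hG : supp t (s.nat 2) = G) :
    Ensures k t O (greedyProgram N) s fun u =>
      supp t (u.nat 2) = greedy F t G (min t (k - k / N)) := by
  rw [greedyProgram, ensures_seq, assign, ensures_setNat]
  refine ensures_loop (fun j u => u.nat 7 0 = min j (k - k / N) ∧
    supp t (u.nat 2) = greedy F t G (min j (k - k / N))) ?_ ?_ fun u hu => hu.2
  · simp [State.tick, State.setNat, NatTerm.eval, hG, greedy]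
  · rintro j hj u ⟨h1, h2⟩
    rw [ensures_ite]
    simp only [Test.Holds, NatTerm.eval, NatTerm.eval_times, scalar, State.tick, h1, guard_iff hN]
    refine ⟨fun hlt => ?_, fun hge => ?_⟩
    · refine (ensures_greedyStepProgram (s := u.tick.tick) hO (Nat.zero_lt_of_lt hj) h2).mono
        fun v hv => ?_
      rw [hv.1, hv.2, show u.tick.tick.nat 7 0 = _ from h1,
        show min (j + 1) (k - k / N) = min j (k - k / N) + 1 by omega,
        greedy_succ]
      exact ⟨rfl, rfl⟩
    · rw [ensures_skip, show min (j + 1) (k - k / N) = min j (k - k / N) by omega]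
      exact ⟨h1, h2⟩

theorem ensures_rebaseProgram {N : ℕ} (hN : 0 < N) (hO : ∀ A, O A = F (supp t A)) :
    Ensures k t O (rebaseProgram N) s fun u =>
      supp t (u.nat 1) = baseSet F N k t (s.nat 4 0) := by
  rw [rebaseProgram, ensures_seq]
  refine ((ensures_forEach (Q := fun u => supp t (u.nat 2) = ∅) (by simp [Program.writes])
    (fun j u => ∀ i < j, u.nat 2 i = 0)
    (fun j u v hn _ h i hi => by rw [hn 2 (by simp), h i hi]) (by simp) ?_ ?_).and
    (ensures_frame _ s)).mono ?_
  · intro j hj u _ h5 h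
    rw [ensures_setNat]
    intro i hi
    by_cases hij : i = j
    · simp [State.tick, State.setNat, NatTerm.eval, scalar, h5, hij]
    · simp [State.tick, State.setNat, NatTerm.eval, scalar, h5, hij, h i (by omega)]
  · intro u hu
    ext i
    simpa [mem_supp] using hu i
  rintro u ⟨hu, hfu⟩
  have hu4 := hfu 4 (by simp [Program.writes, forEach, assign])
  rw [ensures_seq]
  refine ((ensures_greedyProgram hN hO hu).and (ensures_frame _ u)).mono ?_
  rintro v ⟨hv, hfv⟩
  have hv4 := hfv 4 (by simp [Program.writes, forEach, assign, greedyProgram, greedyStepProgram, scanBody])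
  rw [ensures_seq]
  refine ((ensures_forEach (Q := fun u => supp t (u.nat 1) = supp t (v.nat 2))
    (by simp [Program.writes])
    (fun j u => ∀ i < j, u.nat 1 i = v.nat 2 i)
    (fun j u v hn _ h i hi => by rw [hn 1 (by simp), h i hi]) (by simp) ?_ ?_).and
    (ensures_frame _ v)).mono ?_
  · intro j hj u hfr h5 h
    have h2 := hfr 2 (by simp) (by simp [Program.writes])
    rw [ensures_setNat]
    intro i hi
    by_cases hij : i = j
    · simp [State.tick, State.setNat, NatTerm.eval, scalar, entry, h5, hij, h2]
    · simp [State.tick, State.setNat, NatTerm.eval, scalar, entry, h5, hij, h i (by omega)]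
  · exact fun u hu => supp_congr hu
  rintro w ⟨hw, hfw⟩
  have hw4 := hfw 4 (by simp [Program.writes, forEach, assign])
  have hw2 := hfw 2 (by simp [Program.writes, forEach, assign])
  rw [ensures_ite]
  simp only [Test.Holds, NatTerm.eval, scalar, State.tick, hw4, hv4, hu4, Nat.le_zero]
  refine ⟨fun h0 => ?_, fun h0 => ?_⟩
  · rw [ensures_seq]
    refine ((ensures_greedyProgram (G := supp t (v.nat 2)) hN hO (by rw [hw2])).and
      (ensures_frame _ _)).mono ?_
    rintro y ⟨hy, hfy⟩
    have hy1 := hfy 1 (by simp [Program.writes, assign, greedyProgram, greedyStepProgram,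
      forEach, scanBody])
    refine ensures_forEach (by simp [Program.writes])
      (fun j u => (∀ i < j, u.nat 1 i ≠ 0 ↔ y.nat 2 i ≠ 0 ∧ w.nat 1 i = 0) ∧
        ∀ i, j ≤ i → u.nat 1 i = w.nat 1 i) ?_ ?_ ?_ ?_
    · intro j u v hn _ h
      rw [hn 1 (by simp)]
      exact h
    · simp [hy1]
    · rintro j hj u hfr h5 ⟨h, h'⟩
      have h2 := hfr 2 (by simp) (by simp [Program.writes])
      have hj1 := h' j le_rfl
      rw [ensures_ite, ensures_setNat, ensures_setNat]
      simp only [Test.Holds, NatTerm.eval, entry, scalar, State.tick, State.setNat, h5, hj1, h2,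
        Function.update_self, Function.update_apply]
      grind
    · rintro u ⟨h, -⟩
      rw [baseSet, if_pos h0, ← hv, ← hy, ← hw]
      ext i
      simp only [Finset.mem_sdiff, mem_supp]
      grind
  · rw [ensures_skip]
    simp only [State.tick, baseSet, if_neg h0, ← hv, hw]

theorem supp_succ (t : ℕ) (A : ℕ → ℕ) :
    supp (t + 1) A = if A t = 0 then supp t A else insert t (supp t A) := by
  ext i
  rcases lt_trichotomy i t with h | rfl | h
  · split_ifs <;> simp [mem_supp, h, h.ne, h.trans (Nat.lt_succ_self t)]
  · split_ifs with h <;> simp [mem_supp, h]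
  · split_ifs <;> simp [mem_supp, h.ne', h.not_gt] <;> omega

theorem ensures_updateProgram (C : ℕ) :
    Ensures k t O (updateProgram C) s fun u =>
      supp t (u.nat 0) ⊆ supp t (s.nat 1) ∧
      supp t (s.nat 0) ∩ supp t (s.nat 1) ⊆ supp t (u.nat 0) ∧
      (supp t (u.nat 0) \ supp t (s.nat 0)).card ≤ C ∧
      ((supp t (u.nat 0) \ supp t (s.nat 0)).card = C ∨ supp t (u.nat 0) = supp t (s.nat 1)) ∧
      ∀ i, t ≤ i → u.nat 0 i = s.nat 0 i := by
  rw [updateProgram, ensures_seq, assign, ensures_setNat]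
  refine ensures_forEach (by simp [assign, Program.writes])
    (fun j u => u.nat 7 0 ≤ C ∧ supp j (u.nat 0) ⊆ supp j (s.nat 1) ∧
      supp j (s.nat 0) ∩ supp j (s.nat 1) ⊆ supp j (u.nat 0) ∧
      (supp j (u.nat 0) \ supp j (s.nat 0)).card = u.nat 7 0 ∧
      (u.nat 7 0 = C ∨ supp j (u.nat 0) = supp j (s.nat 1)) ∧
      ∀ i, j ≤ i → u.nat 0 i = s.nat 0 i) ?_ ?_ ?_ ?_
  · intro j u v hn _ h
    rw [hn 0 (by simp), hn 7 (by simp)]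
    exact h
  · simp [State.tick, State.setNat, NatTerm.eval, supp]
  · rintro j hj u hfr h5 ⟨h1, h2, h3, h4, h6, h7⟩
    have hT : u.nat 1 = s.nat 1 := by
      rw [hfr 1 (by simp) (by simp [Program.writes, assign])]
      simp [State.tick, State.setNat]
    have hj0 := h7 j le_rfl
    have hold : ∀ v, supp j (Function.update (u.nat 0) j v) = supp j (u.nat 0) :=
      fun v => supp_congr fun i hi => Function.update_of_ne hi.ne _ _
    have hnot : ∀ A, j ∉ supp j A := fun A => by simp [mem_supp]
    have hrest : ∀ v i, j + 1 ≤ i → Function.update (u.nat 0) j v i = s.nat 0 i :=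
      fun v i hi => by rw [Function.update_of_ne (by omega), h7 i (by omega)]
    have hins : ∀ A B : Finset ℕ, j ∉ A → j ∉ B → (insert j A \ insert j B) = A \ B := by
      intro A B hA hB
      ext i
      simp only [Finset.mem_sdiff, Finset.mem_insert]
      grind
    simp only [assign, ensures_seq, ensures_setNat, ensures_ite, ensures_skip, Test.Holds,
      NatTerm.eval, State.tick, State.setNat, scalar, entry, h5, hT, hj0, Nat.le_zero]
    refine ⟨fun hT0 => ?_, fun hT0 => ⟨fun hA => ?_, fun hA => ?_⟩⟩
    · by_cases hs : s.nat 0 j = 0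
      · simp [supp_succ, hT0, hs, hold, h1, h2, h3, h4, h6]
        exact hrest 0
      · simp [supp_succ, hT0, hs, hold, h1, h2, h3, h4, h6, Finset.sdiff_insert_of_notMem, hnot,
          Finset.insert_inter_of_notMem]
        exact hrest 0
    · have hs := hA.1
      have hcard : (insert j (supp j (u.nat 0)) \ supp j (s.nat 0)).card = u.nat 7 0 + 1 := by
        rw [Finset.insert_sdiff_of_notMem _ (hnot _), Finset.card_insert_of_notMem
          (fun h => hnot _ (Finset.mem_sdiff.mp h).1), h4]
      have hsub := Finset.insert_subset_insert j h2
      have hinter : supp j (s.nat 0) ∩ insert j (supp j (s.nat 1)) ⊆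
          insert j (supp j (u.nat 0)) := by
        rw [Finset.inter_insert_of_notMem (hnot _)]
        exact h3.trans (Finset.subset_insert _ _)
      simp [supp_succ, hT0, hs, hold, hcard, hsub, hinter]
      refine ⟨hA.2, ?_, hrest 1⟩
      rcases h6 with h6 | h6
      · have := hA.2
        omega
      · exact .inr (by rw [h6])
    · by_cases hs : s.nat 0 j = 0
      · have hC : u.nat 7 0 = C := by
          have : ¬ u.nat 7 0 + 1 ≤ C := fun h => hA ⟨hs, h⟩
          omega
        have hsub := h2.trans (Finset.subset_insert j _)
        simp [supp_succ, hT0, hs, hj0, h4, hC, hsub, Finset.inter_insert_of_notMem, hnot, h3]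
        exact fun i hi => h7 i hi.le
      · have hsub := Finset.insert_subset_insert j h2
        have hinter := Finset.insert_subset_insert j h3
        rw [Finset.insert_inter_distrib] at hinter
        simp only [supp_succ, hT0, hs, hj0, if_false, hins _ _ (hnot _) (hnot _), hsub, hinter, h4,
          h1, true_and]
        exact ⟨h6.imp_right fun h => by rw [h], fun i hi => h7 i (by omega)⟩
  · rintro u ⟨h1, h2, h3, h4, h6, h7⟩
    rw [h4]
    exact ⟨h2, h3, h1, h6, h7⟩

end Correctness


/-! ### The invariant of the algorithm -/

/-- The phase after `t` time steps and the last time at which the target was computed anew, when the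
phase starts at `c₀`. -/
def phase (N k c₀ : ℕ) : ℕ → ℕ × ℕ
  | 0 => (c₀, 0)
  | t + 1 =>
    if k + 1 ≤ (phase N k c₀ t).1 + N then ((phase N k c₀ t).1 + N - (k + 1), t + 1)
    else ((phase N k c₀ t).1 + N, (phase N k c₀ t).2)

section Phase

variable {N k c₀ : ℕ}

theorem phase_fst_le (hN : N ≤ k) (hc : c₀ ≤ k) (t : ℕ) : (phase N k c₀ t).1 ≤ k := by
  induction t with
  | zero => exact hc
  | succ t ih =>
    rw [phase]
    split_ifs <;> simp only <;> omega

theorem phase_fst (hN : N ≤ k) (hc : c₀ ≤ k) (t : ℕ) :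
    (phase N k c₀ t).1 = (c₀ + N * t) % (k + 1) := by
  have hle := phase_fst_le hN hc
  induction t with
  | zero => simp [phase, Nat.mod_eq_of_lt (Nat.lt_succ_of_le hc)]
  | succ t ih =>
    have h1 := hle t
    have h2 : (c₀ + N * (t + 1)) % (k + 1) = ((phase N k c₀ t).1 + N) % (k + 1) := by
      rw [ih, Nat.mod_add_mod, mul_add, mul_one, add_assoc]
    rw [h2, phase]
    split_ifs with h
    · rw [Nat.mod_eq_sub_mod h, Nat.mod_eq_of_lt (by omega)]
    · rw [Nat.mod_eq_of_lt (by omega)]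

theorem phase_snd_le (t : ℕ) : (phase N k c₀ t).2 ≤ t := by
  induction t with
  | zero => simp [phase]
  | succ t ih =>
    rw [phase]
    split_ifs <;> simp only <;> omega

/-- Few elements arrive between two computations of the target. -/
theorem sub_phase_snd_le (hN : 0 < N) (hc : c₀ ≤ k) (t : ℕ) :
    t - (phase N k c₀ t).2 ≤ k / N := by
  rw [Nat.le_div_iff_mul_le hN]
  rcases le_or_gt N k with h | h
  · refine le_trans ?_ (phase_fst_le h hc t)
    induction t with
    | zero => simp
    | succ t ih =>
      have := phase_snd_le (N := N) (k := k) (c₀ := c₀) t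
      rw [phase]
      split_ifs
      · simp
      · simp only
        rw [Nat.succ_sub this, Nat.succ_mul]
        omega
  · rcases t with _ | t
    · simp
    · rw [phase, if_pos (by omega)]
      simp

end Phase

section Target

variable (F : Finset ℕ → ℝ) (N k c₀ w : ℕ)

/-- The set that the solution is moved towards: a greedy solution for the elements present at the
last rebasing, together with all later elements. -/
noncomputable def target (t : ℕ) : Finset ℕ :=
  baseSet F N k (phase N k c₀ t).2 w ∪ Finset.Ico (phase N k c₀ t).2 t

variable {N k c₀}

theorem card_target_le (hN : 0 < N) (hc : c₀ ≤ k) (t : ℕ) : (target F N k c₀ w t).card ≤ k := by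
  refine (Finset.card_union_le _ _).trans ?_
  have h1 := card_baseSet_le F N k (phase N k c₀ t).2 w
  have h2 := sub_phase_snd_le hN hc t
  have h3 : k / N ≤ k := Nat.div_le_self _ _
  rw [Nat.card_Ico]
  omega

theorem target_succ_of_le {t : ℕ} (h : k + 1 ≤ (phase N k c₀ t).1 + N) :
    target F N k c₀ w (t + 1) = baseSet F N k (t + 1) w := by
  simp [target, phase, h]

theorem target_succ_of_not_le {t : ℕ} (h : ¬ k + 1 ≤ (phase N k c₀ t).1 + N) :
    target F N k c₀ w (t + 1) = insert t (target F N k c₀ w t) := by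
  simp only [target, phase, h, if_false]
  rw [← Finset.insert_Ico_right_eq_Ico_add_one (phase_snd_le t), Finset.union_insert]

end Target

/-- The configurations that are reached after `t` time steps when the draws are `c₀` and `w`.  The
number of elements that the solution lacks is zero once the phase has grown to `k / N`. -/
structure Inv (F : Finset ℕ → ℝ) (N k c₀ w t : ℕ) (s : State) : Prop where
  phase_eq : s.nat 3 0 = (phase N k c₀ t).1
  coin_eq : s.nat 4 0 = w
  supp_target : supp t (s.nat 1) = target F N k c₀ w t
  zero : ∀ i, t ≤ i → s.nat 0 i = 0
  subset : supp t (s.nat 0) ⊆ target F N k c₀ w t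
  missing : (target F N k c₀ w t \ supp t (s.nat 0)).card = 0 ∨
    N ≤ k ∧ (target F N k c₀ w t \ supp t (s.nat 0)).card + N * (phase N k c₀ t).1 ≤ k

section Step

variable {F : Finset ℕ → ℝ} {N k c₀ w t : ℕ} {s : State} {O : (ℕ → ℕ) → ℝ}

theorem inv_zero (h3 : s.nat 3 0 = c₀) (h4 : s.nat 4 0 = w) (h0 : ∀ i, s.nat 0 i = 0) :
    Inv F N k c₀ w 0 s := by
  have hT : target F N k c₀ w 0 = ∅ := by
    have := baseSet_subset_range F N k 0 w
    rw [Finset.range_zero, Finset.subset_empty] at this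
    simp [target, phase, this]
  constructor <;> simp [h3, h4, h0, hT, phase, supp]

/-- One time step preserves the invariant and inserts at most `N ^ 2 + 1` elements. -/
theorem ensures_stepProgram (hN : 0 < N) (hc : c₀ ≤ k) (hO : ∀ A, O A = F (supp (t + 1) A))
    (hs : Inv F N k c₀ w t s) :
    Ensures k (t + 1) O (stepProgram N) s fun u => Inv F N k c₀ w (t + 1) u ∧
      (supp (t + 1) (u.nat 0) \ supp t (s.nat 0)).card ≤ N ^ 2 + 1 := by
  have hold : supp (t + 1) (s.nat 0) = supp t (s.nat 0) := by
    rw [supp_succ, if_pos (hs.zero t le_rfl)]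
  -- The first part of the program brings the phase and the target up to date.
  have hfirst : Ensures k (t + 1) O (.seq (assign 3 (.add (scalar 3) (.lit N)))
      (.ite (.natLE (.add .bound (.lit 1)) (scalar 3))
        (.seq (assign 3 (.sub (scalar 3) (.add .bound (.lit 1)))) (rebaseProgram N))
        (.setNat 1 (.sub .arrivals (.lit 1)) (.lit 1)))) s fun u =>
      u.nat 3 0 = (phase N k c₀ (t + 1)).1 ∧ u.nat 4 0 = w ∧ u.nat 0 = s.nat 0 ∧
        supp (t + 1) (u.nat 1) = target F N k c₀ w (t + 1) := by
    rw [ensures_seq, assign, ensures_setNat, ensures_ite]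
    simp only [Test.Holds, NatTerm.eval, scalar, State.tick, State.setNat, Function.update_self,
      hs.phase_eq]
    refine ⟨fun h => ?_, fun h => ?_⟩
    · rw [ensures_seq, assign, ensures_setNat]
      refine ((ensures_rebaseProgram hN hO).and (ensures_frame _ _)).mono ?_
      rintro u ⟨hu, hfr⟩
      have hw : ∀ a, a = 0 ∨ a = 3 ∨ a = 4 → a ∉ (rebaseProgram N).writes := by
        rintro a (rfl | rfl | rfl) <;>
        simp [rebaseProgram, greedyProgram, greedyStepProgram, scanBody, forEach, assign,
          Program.writes]
      rw [hfr 0 (hw 0 (by simp)), hfr 3 (hw 3 (by simp)), hfr 4 (hw 4 (by simp)), hu,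
        target_succ_of_le F w h]
      simp [phase, h, State.tick, State.setNat, NatTerm.eval, hs.coin_eq]
    · rw [ensures_setNat, target_succ_of_not_le F w h, ← hs.supp_target]
      simp [phase, h, State.tick, State.setNat, NatTerm.eval, hs.coin_eq, supp_succ]
      exact congrArg _ (supp_congr fun i hi => Function.update_of_ne hi.ne _ _)
  have hseq : ∀ {c₁ c₂ c₃ : Program} {Q : State → Prop}, Ensures k (t + 1) O (.seq c₁ c₂) s
      (fun u => Ensures k (t + 1) O c₃ u Q) → Ensures k (t + 1) O (.seq c₁ (.seq c₂ c₃)) s Q := by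
    intro c₁ c₂ c₃ Q h
    simpa only [ensures_seq] using h
  refine hseq (hfirst.mono ?_)
  rintro u ⟨h3, h4, h0, h1⟩
  refine ((ensures_updateProgram (N ^ 2 + 1)).and (ensures_frame _ u)).mono ?_
  rintro v ⟨⟨hsub, hinter, hcard, hor, hzero⟩, hfr⟩
  have hw : ∀ a, a = 1 ∨ a = 3 ∨ a = 4 → v.nat a = u.nat a := by
    rintro a ha
    refine hfr a ?_
    rcases ha with rfl | rfl | rfl <;> simp [updateProgram, forEach, assign, Program.writes]
  rw [h0, hold] at hinter hcard hor
  rw [h1] at hsub hinter hor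
  refine ⟨⟨by rw [hw 3 (by simp), h3], by rw [hw 4 (by simp), h4], by rw [hw 1 (by simp), h1],
    fun i hi => by rw [hzero i hi, h0, hs.zero i (by omega)], hsub, ?_⟩, hcard⟩
  set A := supp t (s.nat 0) with hA
  set A' := supp (t + 1) (v.nat 0) with hA'
  rcases hor with hC | heq
  swap
  · exact .inl (by simp [heq])
  have hsum : (target F N k c₀ w (t + 1) \ A').card + (N ^ 2 + 1) ≤
      (target F N k c₀ w (t + 1) \ A).card := by
    rw [← hC, ← Finset.card_union_of_disjoint
      (Finset.disjoint_left.mpr fun i h h' => by grind)]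
    exact Finset.card_le_card fun i hi => by grind
  by_cases h : k + 1 ≤ (phase N k c₀ t).1 + N
  · -- After a rebasing the phase is below `N` and `N ^ 2 + 1` elements have been inserted.
    have hle := (Finset.card_le_card Finset.sdiff_subset).trans (card_target_le F w hN hc (t + 1)) |>.trans'
      hsum
    have hNk : N ≤ k := by nlinarith
    have := phase_fst_le hNk hc t
    have hph : (phase N k c₀ (t + 1)).1 ≤ N := by
      rw [phase, if_pos h]
      simp only
      omega
    refine .inr ⟨hNk, ?_⟩
    nlinarith
  · have hle : (target F N k c₀ w (t + 1) \ A).card ≤ (target F N k c₀ w t \ A).card + 1 := by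
      rw [target_succ_of_not_le F w h]
      refine (Finset.card_le_card ?_).trans (Finset.card_insert_le t _)
      intro i
      grind
    have hph : (phase N k c₀ (t + 1)).1 = (phase N k c₀ t).1 + N := by
      rw [phase, if_neg h]
    rw [hph]
    rcases hs.missing with h0 | ⟨hNk, h0⟩
    · have : 0 < N ^ 2 := by positivity
      exfalso
      linarith
    · refine .inr ⟨hNk, ?_⟩
      nlinarith

/-- Outside the short period after a rebasing the solution has reached the target. -/
theorem Inv.supp_eq_target (hs : Inv F N k c₀ w t s)
    (h : k ≤ N * (phase N k c₀ t).1 ∨ k < N) : supp t (s.nat 0) = target F N k c₀ w t := by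
  refine hs.subset.antisymm (Finset.sdiff_eq_empty_iff_subset.mp (Finset.card_eq_zero.mp ?_))
  rcases hs.missing with h0 | ⟨hNk, h0⟩ <;> omega

end Step


/-! ### Streams as functions on sets of indices -/

section Pullback

variable {X : Type*} {n : ℕ}

/-- The set of the elements whose indices belong to `I`. -/
def elements (x : Fin n ≃ X) (I : Finset ℕ) : Finset X :=
  (Finset.univ.filter fun i : Fin n => (i : ℕ) ∈ I).map x.toEmbedding

theorem mem_elements {x : Fin n ≃ X} {I : Finset ℕ} {y : X} :
    y ∈ elements x I ↔ (x.symm y : ℕ) ∈ I := by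
  simp only [elements, Finset.mem_map_equiv, Finset.mem_filter, Finset.mem_univ, true_and]

theorem selected_eq (x : Fin n ≃ X) (t : ℕ) (A : ℕ → ℕ) :
    selected x t A = elements x (supp t A) := by
  simp only [selected, elements, mem_supp]

theorem card_elements_le (x : Fin n ≃ X) (I : Finset ℕ) : (elements x I).card ≤ I.card := by
  rw [elements, Finset.card_map]
  exact Finset.card_le_card_of_injOn (fun i => (i : ℕ)) (fun i hi => by simpa using hi)
    Fin.val_injective.injOn

theorem elements_subset (x : Fin n ≃ X) {I J : Finset ℕ} (h : I ⊆ J) :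
    elements x I ⊆ elements x J := by
  intro y
  rw [mem_elements, mem_elements]
  exact fun hy => h hy

theorem exists_opt_eq (x : Fin n ≃ X) (f : Finset X → ℝ) (k t : ℕ) :
    ∃ I ⊆ Finset.range t, I.card ≤ k ∧ opt f k (arrived x t) = f (elements x I) := by
  obtain ⟨O, hO, hOf⟩ := Finset.exists_mem_eq_sup'
    (s := (arrived x t).powerset.filter fun S => S.card ≤ k) ⟨∅, by simp⟩ f
  rw [Finset.mem_filter, Finset.mem_powerset] at hO
  refine ⟨O.image fun y => (x.symm y : ℕ), ?_, Finset.card_image_le.trans hO.2, ?_⟩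
  · intro i hi
    obtain ⟨y, hy, rfl⟩ := Finset.mem_image.mp hi
    have := hO.1 hy
    rw [arrived, Finset.mem_map_equiv, Finset.mem_filter] at this
    exact Finset.mem_range.mpr this.2
  · rw [opt, hOf]
    congr 1
    ext y
    simp [mem_elements, Fin.val_inj]

variable [DecidableEq X]

theorem elements_union (x : Fin n ≃ X) (I J : Finset ℕ) :
    elements x (I ∪ J) = elements x I ∪ elements x J := by
  ext y; simp [mem_elements]

theorem elements_sdiff (x : Fin n ≃ X) (I J : Finset ℕ) :
    elements x (I \ J) = elements x I \ elements x J := by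
  ext y; simp [mem_elements]

variable {x : Fin n ≃ X} {f : Finset X → ℝ}

theorem isMonotone_comp_elements (hf : IsMonotone f) : IsMonotone fun I => f (elements x I) := by
  intro v T
  simp only [marginal, elements_union]
  linarith [hf.le_of_subset (Finset.subset_union_right : elements x T ⊆ elements x {v} ∪ elements x T)]

theorem isSubmodular_comp_elements (hf : IsMonotone f) (hs : IsSubmodular f) :
    IsSubmodular fun I => f (elements x I) := by
  intro S T hST v _
  simp only [marginal, elements_union]
  exact hs.union_le hf (elements_subset x hST) _

end Pullback

/-! ### Value of the target -/

section Value

variable {F : Finset ℕ → ℝ} {N k c₀ t : ℕ}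

/-- Only a small fraction of the value of a set of size `k` is lost by a suitable restriction to the
`k - k / N` elements for which the greedy algorithm has room. -/
theorem exists_subset_card_le (hF : IsMonotone F) (hS : IsSubmodular F) (h0 : ∀ S, 0 ≤ F S)
    (hN : 0 < N) {O : Finset ℕ} (hO : O.card ≤ k) (R : Finset ℕ) :
    ∃ O' ⊆ O, O'.card ≤ k - k / N ∧ (1 - 1 / (N : ℝ)) * F (O ∪ R) ≤ F (O' ∪ R) := by
  have hN' : (0 : ℝ) < N := by exact_mod_cast hN
  rcases le_or_gt O.card (k - k / N) with h | h
  · refine ⟨O, subset_rfl, h, ?_⟩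
    have := h0 (O ∪ R)
    have : 0 ≤ 1 / (N : ℝ) * F (O ∪ R) := by positivity
    linarith
  · obtain ⟨O', hsub, hcard, hval⟩ := hS.exists_subset_card hF h0 O R h.le
    refine ⟨O', hsub, hcard.le, ?_⟩
    have hle : k / N ≤ k := Nat.div_le_self _ _
    have hO0 : (0 : ℝ) < O.card := by exact_mod_cast (Nat.zero_le _).trans_lt h
    have hOk : (O.card : ℝ) ≤ k := by exact_mod_cast hO
    have hk : (0 : ℝ) < k := hO0.trans_le hOk
    have h1 : (1 - 1 / (N : ℝ)) * k ≤ (k - k / N : ℕ) := by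
      rw [Nat.cast_sub hle]
      have : ((k / N : ℕ) : ℝ) ≤ k / N := Nat.cast_div_le
      have e : (1 - 1 / (N : ℝ)) * k = k - k / N := by ring
      linarith
    have h2 : 0 ≤ 1 - 1 / (N : ℝ) := by
      have : (1 : ℝ) ≤ N := by exact_mod_cast hN
      have := (div_le_one hN').mpr this
      linarith
    refine le_of_mul_le_mul_left (le_trans ?_ hval) hO0
    rw [← mul_assoc]
    refine mul_le_mul_of_nonneg_right ?_ (h0 _)
    rw [mul_comm]
    exact (mul_le_mul_of_nonneg_left hOk h2).trans h1

/-- The average value of the target over the coin. -/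
theorem le_average_target (hF : IsMonotone F) (hS : IsSubmodular F) (h0 : ∀ S, 0 ≤ F S)
    (hN : 0 < N) {O : Finset ℕ} (hOt : O ⊆ Finset.range t) (hO : O.card ≤ k) :
    51 / 100 * (1 - 1 / (N : ℝ)) * F O ≤
      1 / 11 * ∑ w : Fin 11, F (target F N k c₀ w t) := by
  set b := (phase N k c₀ t).2 with hb
  set j := min b (k - k / N) with hj
  set R := Finset.Ico b t with hR
  have hbt : b ≤ t := phase_snd_le t
  obtain ⟨O', hsub, hcard, hval⟩ := exists_subset_card_le (N := N) hF hS h0 hN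
    (O := O ∩ Finset.range b) ((Finset.card_le_card Finset.inter_subset_left).trans hO) R
  have hO'b : O' ⊆ Finset.range b := hsub.trans Finset.inter_subset_right
  have hO'j : O'.card ≤ j :=
    le_min (by simpa using Finset.card_le_card hO'b) hcard
  have hrob := (isGreedyChain_greedy hF (min_le_left b (k - k / N)) ∅).robust
    (isGreedyChain_greedy hF (min_le_left b (k - k / N)) (greedy F b ∅ j)) rfl hF hS h0 hO'b hO'j R
  have hOsub : F O ≤ F ((O ∩ Finset.range b) ∪ R) := by
    refine hF.le_of_subset fun i hi => ?_
    have := Finset.mem_range.mp (hOt hi)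
    simp only [hR, Finset.mem_union, Finset.mem_inter, Finset.mem_range, Finset.mem_Ico, hi, true_and]
    omega
  have hsum : ∑ w : Fin 11, F (target F N k c₀ w t) =
      F ((greedy F b (greedy F b ∅ j) j \ greedy F b ∅ j) ∪ R) + 10 * F (greedy F b ∅ j ∪ R) := by
    rw [Fin.sum_univ_succ]
    simp [target, baseSet, ← hb, ← hj, ← hR]
  have h2 : 0 ≤ 1 - 1 / (N : ℝ) := by
    have : (1 : ℝ) ≤ N := by exact_mod_cast hN
    have := (div_le_one (by linarith)).mpr this
    linarith
  have := mul_le_mul_of_nonneg_left hOsub h2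
  rw [hsum]
  linarith

/-- A random phase is rarely so small that the solution may not have reached the target yet. -/
theorem card_bad_le (hN : 0 < N) (hNk : N ≤ k) (t : ℕ) :
    N * (Finset.univ.filter fun c : Fin (k + 1) => N * (phase N k c t).1 < k).card ≤ 2 * k := by
  have h1 : (Finset.univ.filter fun c : Fin (k + 1) => N * (phase N k c t).1 < k).card ≤
      (Finset.range (k / N + 1)).card := by
    refine Finset.card_le_card_of_injOn (fun c => (phase N k c t).1) (fun c hc => ?_) ?_
    · have := (Finset.mem_filter.mp hc).2
      refine Finset.mem_coe.mpr (Finset.mem_range.mpr (Nat.lt_succ_of_le ?_))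
      rw [Nat.le_div_iff_mul_le hN, mul_comm]
      exact this.le
    · intro c _ c' _ h
      simp only [phase_fst hNk (Nat.lt_succ_iff.mp c.2), phase_fst hNk (Nat.lt_succ_iff.mp c'.2)] at h
      have h' : (c : ℕ) ≡ c' [MOD k + 1] := Nat.ModEq.add_right_cancel' (N * t) h
      exact Fin.ext (Nat.ModEq.eq_of_lt_of_lt h' c.2 c'.2)
  rw [Finset.card_range] at h1
  have h2 : N * (k / N) ≤ k := Nat.mul_div_le k N
  calc _ ≤ N * (k / N + 1) := Nat.mul_le_mul_left N h1
    _ ≤ 2 * k := by rw [mul_add]; omega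

end Value

/-! ### Expectations -/

section Expectation

variable {X σ : Type*} [Fintype X]

/-- The expectation of `f (sol s)` for a random `s`. -/
noncomputable def expect (f : Finset X → ℝ) (sol : σ → Finset X) (μ : PMF σ) : ℝ :=
  ∑ S : Finset X, ((μ.map sol) S).toReal * f S

variable {f : Finset X → ℝ} {sol : σ → Finset X}

theorem le_expect {μ : PMF σ} {v : ℝ} (h : ∀ s ∈ μ.support, v ≤ f (sol s)) :
    v ≤ expect f sol μ := by
  have h1 : ∑ S : Finset X, ((μ.map sol) S).toReal = 1 := by
    have := (μ.map sol).tsum_coe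
    rw [tsum_fintype] at this
    rw [← ENNReal.toReal_sum fun S _ => PMF.apply_ne_top _ _, this, ENNReal.toReal_one]
  calc v = ∑ S : Finset X, ((μ.map sol) S).toReal * v := by rw [← Finset.sum_mul, h1, one_mul]
    _ ≤ expect f sol μ := by
      refine Finset.sum_le_sum fun S _ => ?_
      by_cases hS : (μ.map sol) S = 0
      · simp [hS]
      · obtain ⟨s, hs, rfl⟩ := (PMF.mem_support_map_iff sol μ S).mp hS
        exact mul_le_mul_of_nonneg_left (h s hs) ENNReal.toReal_nonneg

theorem expect_uniform_bind (m : ℕ) (κ : Fin (m + 1) → PMF σ) :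
    expect f sol ((PMF.uniformOfFintype (Fin (m + 1))).bind κ) =
      1 / (m + 1 : ℝ) * ∑ i, expect f sol (κ i) := by
  simp only [expect, PMF.map_bind, PMF.bind_apply, PMF.uniformOfFintype_apply, tsum_fintype,
    Fintype.card_fin]
  rw [Finset.sum_comm, Finset.mul_sum]
  refine Finset.sum_congr rfl fun S _ => ?_
  rw [ENNReal.toReal_sum fun i _ => ENNReal.mul_ne_top (by simp) (PMF.apply_ne_top _ _),
    Finset.sum_mul, Finset.mul_sum]
  refine Finset.sum_congr rfl fun i _ => ?_
  rw [ENNReal.toReal_mul, ENNReal.toReal_inv, ENNReal.toReal_natCast]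
  push_cast
  ring

end Expectation

/-! ### Runs of the program -/

section Runs

variable {X : Type*} {n : ℕ}

/-- The run of the program with initial draws `c₀` and `w`, up to time step `t + 1`. -/
noncomputable def runFrom (N k : ℕ) (x : Fin n ≃ X) (f : Finset X → ℝ) (c₀ w : ℕ) : ℕ → PMF State
  | 0 => round (stepProgram N) k x f 1
      ((State.init.tick.setNat 3 0 c₀).tick.setNat 4 0 w).tick
  | t + 1 => (runFrom N k x f c₀ w t).bind (round (mainProgram N) k x f (t + 2))

variable {N k : ℕ} {x : Fin n ≃ X} {f : Finset X → ℝ}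

theorem run_succ (t : ℕ) : run (mainProgram N) k x f (t + 1) =
    (PMF.uniformOfFintype (Fin (k + 1))).bind fun c₀ =>
      (PMF.uniformOfFintype (Fin (10 + 1))).bind fun w => runFrom N k x f c₀ w t := by
  induction t with
  | zero =>
    rw [run, run, PMF.pure_bind, round, mainProgram, exec_seq, initProgram,
      exec_ite_of_holds (by simp [Test.Holds, NatTerm.eval]), exec_seq]
    simp only [PMF.bind_bind, PMF.pure_bind, exec_draw]
    rfl
  | succ t ih =>
    rw [run, ih]
    simp only [PMF.bind_bind, runFrom]

theorem ensures_mainProgram_of_pos {t : ℕ} {O : (ℕ → ℕ) → ℝ} {s : State} {Q : State → Prop}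
    (ht : 0 < t) (h : Ensures k (t + 1) O (stepProgram N) s.tick.tick Q) :
    Ensures k (t + 1) O (mainProgram N) s Q := by
  rw [mainProgram, ensures_seq, initProgram, ensures_ite]
  refine ⟨fun h' => ?_, fun _ => by rwa [ensures_skip]⟩
  simp only [Test.Holds, NatTerm.eval] at h'
  omega

end Runs


/-! ### The guarantees of the program -/

section Guarantees

variable {X : Type*} {n N k : ℕ} {x : Fin n ≃ X} {f : Finset X → ℝ}

theorem inv_of_mem_support_runFrom (hN : 0 < N) {c₀ w : ℕ} (hc : c₀ ≤ k) (t : ℕ) :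
    ∀ s ∈ (runFrom N k x f c₀ w t).support,
      Inv (fun I => f (elements x I)) N k c₀ w (t + 1) s := by
  induction t with
  | zero =>
    refine fun s hs => (ensures_stepProgram hN hc (fun A => by rw [selected_eq])
      (inv_zero ?_ ?_ ?_) s hs).1 <;>
    simp [State.tick, State.setNat, State.init]
  | succ t ih =>
    intro s hs
    rw [runFrom, PMF.mem_support_bind_iff] at hs
    obtain ⟨u, hu, hs⟩ := hs
    have hu' := ih u hu
    refine (ensures_mainProgram_of_pos (Nat.succ_pos t) (ensures_stepProgram hN hc
      (fun A => by rw [selected_eq]) ?_) s hs).1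
    exact ⟨hu'.1, hu'.2, hu'.3, hu'.4, hu'.5, hu'.6⟩

theorem exists_inv (hN : 0 < N) {t : ℕ} {s : State}
    (hs : s ∈ (run (mainProgram N) k x f t).support) :
    ∃ c₀ ≤ k, ∃ w, Inv (fun I => f (elements x I)) N k c₀ w t s := by
  rcases t with _ | t
  · obtain rfl : s = State.init := by simpa [run] using hs
    exact ⟨0, Nat.zero_le _, 0, inv_zero rfl rfl fun _ => rfl⟩
  · rw [run_succ] at hs
    simp only [PMF.mem_support_bind_iff] at hs
    obtain ⟨c₀, -, w, -, hs⟩ := hs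
    exact ⟨c₀, Nat.lt_succ_iff.mp c₀.2, w,
      inv_of_mem_support_runFrom hN (Nat.lt_succ_iff.mp c₀.2) t s hs⟩

theorem isFeasible_mainProgram (hN : 0 < N) : IsFeasible (mainProgram N) k x f := by
  intro t _ s hs
  obtain ⟨c₀, hc, w, hI⟩ := exists_inv hN hs
  rw [solution, selected_eq]
  exact (card_elements_le x _).trans
    ((Finset.card_le_card hI.subset).trans (card_target_le _ w hN hc t))

theorem isConsistent_mainProgram [DecidableEq X] (hN : 0 < N) :
    IsConsistent (mainProgram N) k x f (N ^ 2 + 1 : ℕ) := by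
  intro t _ s hs s' hs'
  rw [solution, solution, selected_eq, selected_eq, ← elements_sdiff]
  refine Nat.cast_le.mpr ((card_elements_le x _).trans ?_)
  have hO : ∀ A, f (selected x (t + 1) A) = f (elements x (supp (t + 1) A)) :=
    fun A => by rw [selected_eq]
  rcases Nat.eq_zero_or_pos t with rfl | ht
  · obtain rfl : s = State.init := by simpa [run] using hs
    revert s'
    change Ensures k 1 _ (mainProgram N) State.init _
    rw [mainProgram, ensures_seq, initProgram, ensures_ite]
    refine ⟨fun _ => ?_, fun h => absurd (by simp [Test.Holds, NatTerm.eval]) h⟩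
    rw [ensures_seq, ensures_draw]
    intro c₀
    rw [ensures_draw]
    intro w
    refine (ensures_stepProgram (F := fun I => f (elements x I)) (c₀ := c₀) (w := w) hN
      (Nat.lt_succ_iff.mp c₀.2) hO (inv_zero ?_ ?_ ?_)).mono fun u hu => hu.2
    all_goals simp [State.tick, State.setNat, State.init, NatTerm.eval]
  · obtain ⟨c₀, hc, w, hI⟩ := exists_inv hN hs
    exact (ensures_mainProgram_of_pos ht (ensures_stepProgram
      (F := fun I => f (elements x I)) (s := s.tick.tick) hN hc hO
      ⟨hI.1, hI.2, hI.3, hI.4, hI.5, hI.6⟩) s' hs').2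

theorem le_expectedValue [Fintype X] [DecidableEq X] (hf : IsMonotone f) (hs : IsSubmodular f)
    (h0 : ∀ S, 0 ≤ f S) (hN : 0 < N) (t : ℕ) :
    (51 / 100 - 2 / N) * opt f k (arrived x t) ≤ expectedValue (mainProgram N) k x f t := by
  have hN' : (0 : ℝ) < N := by exact_mod_cast hN
  change _ ≤ expect f (solution x t) (run (mainProgram N) k x f t)
  obtain ⟨O, hOt, hOk, hopt⟩ := exists_opt_eq x f k t
  rw [hopt]
  set v := f (elements x O) with hv
  have hv0 : 0 ≤ v := h0 _
  rcases t with _ | t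
  · refine le_expect fun s _ => ?_
    have : O = ∅ := by simpa using hOt
    have h1 : v ≤ f (solution x 0 s) := hf.le_of_subset (by simp [this, elements])
    have h2 : 0 ≤ 2 / (N : ℝ) * v := by positivity
    linarith
  rw [run_succ, expect_uniform_bind]
  simp only [expect_uniform_bind]
  -- For draws `c` of the phase outside the exceptional set the solution equals the target.
  set bad := Finset.univ.filter fun c : Fin (k + 1) => N ≤ k ∧ N * (phase N k c (t + 1)).1 < k
    with hbad
  set β := 51 / 100 * (1 - 1 / (N : ℝ)) * v with hβ
  have h1N : 0 ≤ 1 - 1 / (N : ℝ) := by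
    have : (1 : ℝ) ≤ N := by exact_mod_cast hN
    have := (div_le_one hN').mpr this
    linarith
  have hβ0 : 0 ≤ β := by positivity
  have hgood : ∀ c : Fin (k + 1), (if c ∈ bad then 0 else β) ≤
      1 / ((10 : ℕ) + 1 : ℝ) * ∑ w : Fin (10 + 1),
        expect f (solution x (t + 1)) (runFrom N k x f c w t) := by
    intro c
    have hck := Nat.lt_succ_iff.mp c.2
    split_ifs with hc
    · exact mul_nonneg (by positivity) (Finset.sum_nonneg fun w _ => le_expect fun s _ => h0 _)
    · refine (le_average_target (N := N) (c₀ := c) (isMonotone_comp_elements hf)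
        (isSubmodular_comp_elements hf hs) (fun _ => h0 _) hN hOt hOk).trans ?_
      norm_num only [Nat.cast_ofNat]
      refine mul_le_mul_of_nonneg_left (Finset.sum_le_sum fun w _ => le_expect fun s hs => ?_)
        (by norm_num)
      have hI := inv_of_mem_support_runFrom hN hck t s hs
      rw [solution, selected_eq, hI.supp_eq_target]
      simp only [hbad, Finset.mem_filter, Finset.mem_univ, true_and, not_and, not_lt] at hc
      by_cases h : N ≤ k
      · exact .inl (hc h)
      · exact .inr (by omega)
  have hbadle : (N : ℝ) * bad.card ≤ 2 * k := by
    by_cases h : N ≤ k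
    · have := card_bad_le hN h (t + 1)
      simp only [hbad, h, true_and]
      exact_mod_cast this
    · simp [hbad, h]
  have hsum := Finset.sum_le_sum fun c (_ : c ∈ (Finset.univ : Finset (Fin (k + 1)))) => hgood c
  have hcount : ∑ c : Fin (k + 1), (if c ∈ bad then 0 else β) = (k + 1 - bad.card) * β := by
    have : ∀ c : Fin (k + 1), (if c ∈ bad then 0 else β) = β - if c ∈ bad then β else 0 := by
      intro c
      split_ifs <;> simp
    simp only [this, Finset.sum_sub_distrib, Finset.sum_const, Finset.card_univ, Fintype.card_fin,
      nsmul_eq_mul, Finset.sum_ite_mem, Finset.univ_inter]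
    push_cast
    ring
  rw [hcount] at hsum
  have hk : (0 : ℝ) < k + 1 := by positivity
  refine le_trans ?_ (mul_le_mul_of_nonneg_left hsum (by positivity))
  have hfrac : 1 - 2 / (N : ℝ) ≤ 1 / (k + 1) * (k + 1 - bad.card) := by
    have h1 : (bad.card : ℝ) / (k + 1) ≤ 2 / N := by
      rw [div_le_div_iff₀ hk hN']
      linarith
    have h2 : 1 / ((k : ℝ) + 1) * (k + 1 - bad.card) = 1 - bad.card / (k + 1) := by
      field_simp
    linarith
  rw [← mul_assoc]
  refine le_trans ?_ (mul_le_mul_of_nonneg_right hfrac hβ0)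
  have h3 : (1 - 2 / (N : ℝ)) * β - (51 / 100 - 2 / N) * v =
      (47 / 100 * (1 / N) + 102 / 100 * (1 / N) ^ 2) * v := by
    rw [hβ]
    ring
  have h4 : 0 ≤ (47 / 100 * (1 / (N : ℝ)) + 102 / 100 * (1 / N) ^ 2) * v := by positivity
  linarith

theorem eval_mono_nat (p : Polynomial ℕ) {a b : ℕ} (h : a ≤ b) : p.eval a ≤ p.eval b := by
  rw [Polynomial.eval_eq_sum_range, Polynomial.eval_eq_sum_range]
  gcongr

theorem runsInTime_of_loopsOverArrivals {c : Program} (hc : c.LoopsOverArrivals) :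
    RunsInTime c k x f (Polynomial.X * c.timeBound) := by
  intro t _
  rw [Polynomial.eval_mul, Polynomial.eval_X]
  induction t with
  | zero =>
    intro s hs
    obtain rfl : s = State.init := by simpa [run] using hs
    simp [State.init]
  | succ t ih =>
    intro s hs
    rw [run, PMF.mem_support_bind_iff] at hs
    obtain ⟨u, hu, hs⟩ := hs
    have h1 := ih (by omega) u hu
    have h2 : s.clock ≤ u.clock + c.timeBound.eval (t + 1) := ensures_clock c hc u s hs
    have h3 := Nat.mul_le_mul_left t (eval_mono_nat c.timeBound (by omega : t ≤ t + 1))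
    rw [Nat.succ_mul]
    omega

end Guarantees

end ConsistentSubmodular

theorem theorem6p3 :
    ∃ C₁ C₂ : ℝ, 0 < C₁ ∧ 0 < C₂ ∧
      ∀ ε : ℝ, 0 < ε → ε < 1 →
        ∃ (c : ConsistentSubmodular.Program) (p : Polynomial ℕ),
          ∀ (k n : ℕ) (X : Type*) [Fintype X] [DecidableEq X] (x : Fin n ≃ X)
            (f : Finset X → ℝ),
            (∀ S, 0 ≤ f S) →
            ConsistentSubmodular.IsMonotone f →
            ConsistentSubmodular.IsSubmodular f →
              ConsistentSubmodular.IsFeasible c k x f ∧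
              ConsistentSubmodular.IsConsistent c k x f (C₁ / ε ^ 2) ∧
              ConsistentSubmodular.IsApproximation c k x f (51 / 100 - C₂ * ε) ∧
              ConsistentSubmodular.RunsInTime c k x f p := by
  refine ⟨5, 2, by norm_num, by norm_num, fun ε hε hε1 => ?_⟩
  set N := ⌈1 / ε⌉₊ with hNdef
  have hN : 0 < N := Nat.ceil_pos.mpr (by positivity)
  have hN' : (0 : ℝ) < N := by exact_mod_cast hN
  have hle : 1 / ε ≤ N := Nat.le_ceil _
  have hlt : (N : ℝ) < 1 / ε + 1 := Nat.ceil_lt_add_one (by positivity)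
  refine ⟨ConsistentSubmodular.mainProgram N,
    Polynomial.X * (ConsistentSubmodular.mainProgram N).timeBound, ?_⟩
  intro k n X _ _ x f h0 hf hs
  refine ⟨ConsistentSubmodular.isFeasible_mainProgram hN, ?_, ?_,
    ConsistentSubmodular.runsInTime_of_loopsOverArrivals
      (ConsistentSubmodular.mainProgram_loopsOverArrivals N)⟩
  · intro t ht s hs s' hs'
    refine (ConsistentSubmodular.isConsistent_mainProgram hN t ht s hs s' hs').trans ?_
    have h1 : (1 : ℝ) < 1 / ε := by rwa [lt_div_iff₀ hε, one_mul]
    have h2 : (5 : ℝ) / ε ^ 2 = 5 * (1 / ε) ^ 2 := by ring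
    rw [h2]
    push_cast
    nlinarith
  · intro t ht
    refine le_trans ?_ (ConsistentSubmodular.le_expectedValue hf hs h0 hN t)
    have h1 : 2 / (N : ℝ) ≤ 2 * ε := by
      rw [div_le_iff₀ hN']
      rw [div_le_iff₀ hε] at hle
      linarith
    obtain ⟨O, -, -, hO⟩ := ConsistentSubmodular.exists_opt_eq x f k t
    rw [hO]
    exact mul_le_mul_of_nonneg_right (by linarith) (h0 _)
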